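/- **The calculus.** Names $m,n,d,\dots$ are name constants or name variables. The terms of the calculus of minimal higher-order processes with parameterization are, up to $\alpha$-conversion, $$P,Q ::= 0 \mid X \mid m(X).P \mid \overline{m}(Q) \mid P\,|\,Q \mid \langle X\rangle P \mid P\langle Q\rangle \mid \langle x\rangle P \mid P\langle n\rangle ,$$ where $m(X).P$ and $\langle X\rangle P$ bind the process variable $X$ and $\langle x\rangle P$ binds the name variable $x$. Types are $T ::= \diamond \mid T\to T \mid \mathsf{N}\to T$. Given types for the free process variables: $0$ has type $\diamond$; $X$ has its assigned type; $m(X).P$ has type $\diamond$ if $P$ has type $\diamond$ for some choice of a type for $X$; $\overline m(Q)$ has type $\diamond$ if $Q$ has some type; $P\,|\,Q$ has type $\diamond$ if $P$ and $Q$ have type $\diamond$; $\langle X\rangle P$ has type $S\to T$ if $P$ has type $T$ when $X$ has type $S$; $P\langle Q\rangle$ has type $T$ if $P$ has type $S\to T$ and $Q$ has type $S$; $\langle x\rangle P$ has type $\mathsf N\to T$ if $P$ has type $T$; $P\langle n\rangle$ has type $T$ if $P$ has type $\mathsf N\to T$. A term is *well-formed* if it has a type for some assignment of types to its free process variables. **Semantics.**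 Structural congruence $\equiv$ is the smallest congruence on terms with $(P|Q)|R\equiv P|(Q|R)$, $P|Q\equiv Q|P$, $P|0\equiv P$, $(\langle X\rangle P)\langle Q\rangle\equiv P\{Q/X\}$ and $(\langle x\rangle P)\langle m\rangle\equiv P\{m/x\}$. Transitions on (open) terms are generated by $m(X).P\xrightarrow{m(X)}P$; $\overline m(Q)\xrightarrow{\overline m(Q)}0$; if $P\xrightarrow{\lambda}P'$ then $P|Q\xrightarrow{\lambda}P'|Q$ (where the variable bound by $\lambda$, if any, is not free in $Q$); if $P\xrightarrow{\overline m(A)}P'$ and $Q\xrightarrow{m(X)}Q'$ then $P|Q\xrightarrow{\tau}P'|Q'\{A/X\}$; the symmetric rules; and if $Q\equiv P\xrightarrow{\lambda}P'\equiv Q'$ then $Q\xrightarrow{\lambda}Q'$. **Bisimilarity.** A symmetric relation $\mathcal R$ on terms is a *strong HO-IO bisimulation* if $P\,\mathcal R\,Q$ implies, for all names $m,d$ and process variables $X$ (bound variables being chosen fresh): (1) if $P$ is not an abstraction, then neither is $Q$; (2) if $P$ is a process abstraction $\langle Y\rangle A$, then $Q$ is a process abstraction $\langle Y\rangle B$ with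 $A\,\mathcal R\,B$; (3) if $P$ is a name abstraction $\langle y\rangle A$, then $Q$ is a name abstraction $\langle y\rangle B$ with $A\,\mathcal R\,B$; (4) if $P\xrightarrow{\overline m(A)}P'$, then $Q\xrightarrow{\overline m(B)}Q'$ for some $B,Q'$ with $A\,\mathcal R\,B$ and $P'\,\mathcal R\,Q'$; (5) if $P\xrightarrow{m(X)}P'$, then $Q\xrightarrow{m(X)}Q'$ for some $Q'$ with $P'\,\mathcal R\,Q'$; (6) if $P\equiv X\,|\,P'$, then $Q\equiv X\,|\,Q'$ for some $Q'$ with $P'\,\mathcal R\,Q'$; (7) if $P\equiv X\langle A\rangle\,|\,P'$, then $Q\equiv X\langle B\rangle\,|\,Q'$ for some $B,Q'$ with $A\,\mathcal R\,B$ and $P'\,\mathcal R\,Q'$; (8) if $P\equiv X\langle d\rangle\,|\,P'$, then $Q\equiv X\langle d\rangle\,|\,Q'$ for some $Q'$ with $P'\,\mathcal R\,Q'$. Here "is an abstraction" is read up to $\equiv$. The strong bisimilarity $\sim$ is the largest strong HO-IO bisimulation. **Proposition (Cancellation).** For all terms $P$, $Q$ and $R$ such that $P\,|\,R$ and $Q\,|\,R$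 are well-formed, if $P\,|\,R\sim Q\,|\,R$ then $P\sim Q$. -/

import Mathlib

namespace HOmp

/-- Names: name constants and name variables (the latter as de Bruijn indices). -/
inductive Name : Type
  | const (c : ℕ)
  | var (i : ℕ)

/-- Terms of the calculus up to α-conversion, in de Bruijn notation. Process variables and name
variables have separate index spaces: `inp m P` is `m(X).P` and `pabs P` is `⟨X⟩P`, both binding
process variable `0` of `P`; `nabs P` is `⟨x⟩P`, binding name variable `0` of `P`. Indices that
point beyond all binders are the free variables. -/
inductive Term : Type
  | nil
  | var (i : ℕ)
  | inp (m : Name) (P : Term)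
  | out (m : Name) (Q : Term)
  | par (P Q : Term)
  | pabs (P : Term)
  | papp (P Q : Term)
  | nabs (P : Term)
  | napp (P : Term) (n : Name)

/-- Extend a sequence by a new entry for index `0`. -/
def scons {α : Type} (a : α) (f : ℕ → α) : ℕ → α
  | 0 => a
  | i + 1 => f i

/-! ### Substitution of names for name variables -/

def Name.subst (σ : ℕ → Name) : Name → Name
  | .const c => .const c
  | .var i => σ i

/-- The name substitution `σ` carried under a name binder. -/
def nameUp (σ : ℕ → Name) : ℕ → Name :=
  scons (.var 0) fun i => (σ i).subst fun j => .var (j + 1)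

/-- Simultaneous capture-avoiding substitution of names for name variables. -/
def Term.nsubst : (ℕ → Name) → Term → Term
  | _, .nil => .nil
  | _, .var i => .var i
  | σ, .inp m P => .inp (m.subst σ) (P.nsubst σ)
  | σ, .out m Q => .out (m.subst σ) (Q.nsubst σ)
  | σ, .par P Q => .par (P.nsubst σ) (Q.nsubst σ)
  | σ, .pabs P => .pabs (P.nsubst σ)
  | σ, .papp P Q => .papp (P.nsubst σ) (Q.nsubst σ)
  | σ, .nabs P => .nabs (P.nsubst (nameUp σ))
  | σ, .napp P n => .napp (P.nsubst σ) (n.subst σ)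

/-- Weakening by a fresh name variable. -/
def Term.nshift (P : Term) : Term := P.nsubst fun i => .var (i + 1)

/-- `P{m/x}` where `x` is name variable `0` of `P`. -/
def Term.ninst (P : Term) (m : Name) : Term := P.nsubst (scons m .var)

/-! ### Substitution of terms for process variables -/

/-- A renaming of process variables carried under a process-variable binder. -/
def renUp (ρ : ℕ → ℕ) : ℕ → ℕ := scons 0 fun i => ρ i + 1

/-- Renaming of process variables. -/
def Term.rename : (ℕ → ℕ) → Term → Term
  | _, .nil => .nil
  | ρ, .var i => .var (ρ i)
  | ρ, .inp m P => .inp m (P.rename (renUp ρ))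
  | ρ, .out m Q => .out m (Q.rename ρ)
  | ρ, .par P Q => .par (P.rename ρ) (Q.rename ρ)
  | ρ, .pabs P => .pabs (P.rename (renUp ρ))
  | ρ, .papp P Q => .papp (P.rename ρ) (Q.rename ρ)
  | ρ, .nabs P => .nabs (P.rename ρ)
  | ρ, .napp P n => .napp (P.rename ρ) n

/-- Weakening by a fresh process variable. -/
def Term.shift (P : Term) : Term := P.rename Nat.succ

/-- A process substitution carried under a process-variable binder. -/
def termUp (σ : ℕ → Term) : ℕ → Term := scons (.var 0) fun i => (σ i).shift

/-- Simultaneous capture-avoiding substitution of terms for process variables. -/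
def Term.subst : (ℕ → Term) → Term → Term
  | _, .nil => .nil
  | σ, .var i => σ i
  | σ, .inp m P => .inp m (P.subst (termUp σ))
  | σ, .out m Q => .out m (Q.subst σ)
  | σ, .par P Q => .par (P.subst σ) (Q.subst σ)
  | σ, .pabs P => .pabs (P.subst (termUp σ))
  | σ, .papp P Q => .papp (P.subst σ) (Q.subst σ)
  | σ, .nabs P => .nabs (P.subst fun i => (σ i).nshift)
  | σ, .napp P n => .napp (P.subst σ) n

/-- `P{Q/X}` where `X` is process variable `0` of `P`. -/
def Term.inst (P Q : Term) : Term := P.subst (scons Q .var)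

/-! ### Well-formed terms -/

/-- Types of finite order: non-abstractions, abstractions on a term of type `S`,
abstractions on a name. -/
inductive Ty : Type
  | proc
  | pabs (S T : Ty)
  | nabs (T : Ty)

/-- Typing, relative to an assignment `Γ` of types to the free process variables. Only
non-abstractions may be prefixed or put in parallel; terms of every type may be sent, received and
used as arguments. -/
inductive HasType : (ℕ → Ty) → Term → Ty → Prop
  | nil (Γ) : HasType Γ .nil .proc
  | var (Γ) (i : ℕ) : HasType Γ (.var i) (Γ i)
  | inp {Γ m P S} : HasType (scons S Γ) P .proc → HasType Γ (.inp m P) .proc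
  | out {Γ m Q S} : HasType Γ Q S → HasType Γ (.out m Q) .proc
  | par {Γ P Q} : HasType Γ P .proc → HasType Γ Q .proc → HasType Γ (.par P Q) .proc
  | pabs {Γ P S T} : HasType (scons S Γ) P T → HasType Γ (.pabs P) (.pabs S T)
  | papp {Γ P Q S T} : HasType Γ P (.pabs S T) → HasType Γ Q S → HasType Γ (.papp P Q) T
  | nabs {Γ P T} : HasType Γ P T → HasType Γ (.nabs P) (.nabs T)
  | napp {Γ P n T} : HasType Γ P (.nabs T) → HasType Γ (.napp P n) T

/-- A term is well-formed if it is typable. -/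
def WellFormed (P : Term) : Prop := ∃ Γ T, HasType Γ P T

/-! ### Structural congruence -/

/-- Structural congruence: the smallest congruence containing the commutative monoid laws of
parallel composition and the two application laws. -/
inductive SCong : Term → Term → Prop
  | refl (P) : SCong P P
  | symm {P Q} : SCong P Q → SCong Q P
  | trans {P Q R} : SCong P Q → SCong Q R → SCong P R
  | inp (m) {P P'} : SCong P P' → SCong (.inp m P) (.inp m P')
  | out (m) {P P'} : SCong P P' → SCong (.out m P) (.out m P')
  | par {P P' Q Q'} : SCong P P' → SCong Q Q' → SCong (.par P Q) (.par P' Q')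
  | pabs {P P'} : SCong P P' → SCong (.pabs P) (.pabs P')
  | papp {P P' Q Q'} : SCong P P' → SCong Q Q' → SCong (.papp P Q) (.papp P' Q')
  | nabs {P P'} : SCong P P' → SCong (.nabs P) (.nabs P')
  | napp {P P'} (n) : SCong P P' → SCong (.napp P n) (.napp P' n)
  | par_assoc (P Q R) : SCong (.par (.par P Q) R) (.par P (.par Q R))
  | par_comm (P Q) : SCong (.par P Q) (.par Q P)
  | par_nil (P) : SCong (.par P .nil) P
  | papp_pabs (P Q) : SCong (.papp (.pabs P) Q) (P.inst Q)
  | napp_nabs (P m) : SCong (.napp (.nabs P) m) (P.ninst m)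

/-! ### Labelled transitions -/

/-- Actions: input `m(X)`, output of a term, interaction. -/
inductive Act : Type
  | inp (m : Name)
  | out (m : Name) (A : Term)
  | tau

/-- A component that does not take part in an action. The target of an input action `m(X)` has the
fresh variable `X` as process variable `0`, so bystanders are weakened. -/
def Act.idle : Act → Term → Term
  | .inp _, Q => Q.shift
  | .out _ _, Q => Q
  | .tau, Q => Q

/-- The (late) transition relation on open terms. After an input action `m(X)` the variable `X`
is process variable `0` of the target. -/
inductive Trans : Term → Act → Term → Prop
  | inp (m P) : Trans (.inp m P) (.inp m) P
  | out (m Q) : Trans (.out m Q) (.out m Q) .nil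
  | parL {P P' l} (Q) : Trans P l P' → Trans (.par P Q) l (.par P' (l.idle Q))
  | parR {Q Q' l} (P) : Trans Q l Q' → Trans (.par P Q) l (.par (l.idle P) Q')
  | comL {P P' Q Q' m A} : Trans P (.out m A) P' → Trans Q (.inp m) Q' →
      Trans (.par P Q) .tau (.par P' (Q'.inst A))
  | comR {P P' Q Q' m A} : Trans P (.inp m) P' → Trans Q (.out m A) Q' →
      Trans (.par P Q) .tau (.par (P'.inst A) Q')
  | struct {P P' Q Q' l} : SCong Q P → Trans P l P' → SCong P' Q' → Trans Q l Q'

/-! ### Strong HO-IO bisimilarity -/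

/-- Being an abstraction, read up to structural congruence (so that pending applications
are carried out). -/
def IsAbstraction (P : Term) : Prop :=
  (∃ A, SCong P (.pabs A)) ∨ ∃ A, SCong P (.nabs A)

/-- Strong HO-IO bisimulations. Bodies of abstractions and targets of inputs are compared as open
terms, with the freshly freed variable at index `0` on both sides. -/
structure IsHOIOBisimulation (R : Term → Term → Prop) : Prop where
  symm : ∀ {P Q}, R P Q → R Q P
  nonAbs : ∀ {P Q}, R P Q → ¬ IsAbstraction P → ¬ IsAbstraction Q
  pabs : ∀ {P Q}, R P Q → ∀ A, SCong P (.pabs A) → ∃ B, SCong Q (.pabs B) ∧ R A B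
  nabs : ∀ {P Q}, R P Q → ∀ A, SCong P (.nabs A) → ∃ B, SCong Q (.nabs B) ∧ R A B
  out : ∀ {P Q}, R P Q → ∀ m A P', Trans P (.out m A) P' →
    ∃ B Q', Trans Q (.out m B) Q' ∧ R A B ∧ R P' Q'
  inp : ∀ {P Q}, R P Q → ∀ m P', Trans P (.inp m) P' → ∃ Q', Trans Q (.inp m) Q' ∧ R P' Q'
  var : ∀ {P Q}, R P Q → ∀ i P', SCong P (.par (.var i) P') →
    ∃ Q', SCong Q (.par (.var i) Q') ∧ R P' Q'
  papp : ∀ {P Q}, R P Q → ∀ i A P', SCong P (.par (.papp (.var i) A) P') →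
    ∃ B Q', SCong Q (.par (.papp (.var i) B) Q') ∧ R A B ∧ R P' Q'
  napp : ∀ {P Q}, R P Q → ∀ i d P', SCong P (.par (.napp (.var i) d) P') →
    ∃ Q', SCong Q (.par (.napp (.var i) d) Q') ∧ R P' Q'

/-- Strong bisimilarity: the largest strong HO-IO bisimulation, i.e. the union of all of them. -/
def Bisim (P Q : Term) : Prop := ∃ R, IsHOIOBisimulation R ∧ R P Q

end HOmp

namespace HOmp

/-! ### Substitution algebra -/

/-! The argument is a descent on the common component. Let `P | R ∼ Q | R` and let `P` make an
observation, leaving `P'`. If the matching observation of `Q | R` is made by `Q`, the residuals are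
again bisimilar next to `R`. If it is made by `R`, leaving `R'`, then `P' | R ∼ Q | R'`. Now `R` on
the left makes that same observation, giving `P' | R'`; the right side answers either from `Q`,
leaving `P' | R' ∼ Q' | R'`, or from `R'`, leaving `P' | R' ∼ Q | R''`, and so on. If `R` admits
only observation sequences of bounded length, `Q` must eventually answer, and `P'`, `Q'` end up
bisimilar next to a common bounded component. This is `Bisim.exchange_head` and
`Bisim.exchange_inp`; the bisimulation is `CancelRel`, where the common component is existentially
quantified because it changes along the way.

Typing enters twice. It bounds the observations of `R` (`HasType.bounded`), by a reducibility
argument over types in which boundedness plays the role of normalisation; untyped self-application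
would allow `R ≡ C | R`, for which cancellation fails. It also keeps `P`, `Q` and their residuals
from being abstractions, which cannot be seen inside a parallel composition.

The descent needs to know that an observable component of `P | R` comes from `P` or from `R`
(`SCong.par_split`). Since `≡` contains application laws in both directions, this rests on a
Church–Rosser theorem: congruent terms have reducts equal up to associativity and commutativity
(`SCong.joinable`). It is proved with superdevelopments, whose complete form gives the diamond
property, and which commute with associativity and commutativity. Prefixes and applied variables
keep their shape under reduction, so they can be traced through the multiset of parallel components.

Inputs introduce fresh variables. When the descent repeats an input, the new variable has to be
identified with the earlier one, so bisimilarity must be closed under renamings that need not be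
injective (`Bisim.rename`). -/

theorem scons_succ {α : Type} (a : α) (f : ℕ → α) (i : ℕ) : scons a f (i + 1) = f i := rfl

theorem scons_ext {α : Type} {f g : ℕ → α} (h0 : f 0 = g 0) (hs : ∀ i, f (i + 1) = g (i + 1)) :
    f = g := by
  funext i
  cases i with
  | zero => exact h0
  | succ i => exact hs i

theorem Name.subst_subst (σ τ : ℕ → Name) (n : Name) :
    (n.subst σ).subst τ = n.subst fun i => (σ i).subst τ := by
  cases n <;> rfl

theorem Name.subst_var (n : Name) : n.subst .var = n := by
  cases n <;> rfl

theorem nameUp_var : nameUp .var = .var := scons_ext rfl fun _ => rfl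

theorem nameUp_comp (σ τ : ℕ → Name) :
    (fun i => (nameUp σ i).subst (nameUp τ)) = nameUp fun i => (σ i).subst τ := by
  refine scons_ext rfl fun i => ?_
  simp only [nameUp, scons_succ, Name.subst_subst]
  rfl

theorem Term.nsubst_var (P : Term) : P.nsubst .var = P := by
  induction P <;> simp_all [Term.nsubst, Name.subst_var, nameUp_var]

theorem Term.nsubst_nsubst (P : Term) : ∀ σ τ : ℕ → Name,
    (P.nsubst σ).nsubst τ = P.nsubst fun i => (σ i).subst τ := by
  induction P <;> intro σ τ <;> simp_all [Term.nsubst, Name.subst_subst, nameUp_comp]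

theorem renUp_id : renUp id = id := scons_ext rfl fun _ => rfl

theorem renUp_comp (ρ θ : ℕ → ℕ) : renUp θ ∘ renUp ρ = renUp (θ ∘ ρ) :=
  scons_ext rfl fun _ => rfl

theorem Term.rename_id (P : Term) : P.rename id = P := by
  induction P <;> simp_all [Term.rename, renUp_id]

theorem Term.rename_rename (P : Term) : ∀ ρ θ : ℕ → ℕ,
    (P.rename ρ).rename θ = P.rename (θ ∘ ρ) := by
  induction P <;> intro ρ θ <;> simp_all [Term.rename, renUp_comp]

theorem Term.rename_nsubst (P : Term) : ∀ (ρ : ℕ → ℕ) (ν : ℕ → Name),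
    (P.rename ρ).nsubst ν = (P.nsubst ν).rename ρ := by
  induction P <;> intro ρ ν <;> simp_all [Term.rename, Term.nsubst]

theorem termUp_comp_renUp (ρ : ℕ → ℕ) (σ : ℕ → Term) : termUp σ ∘ renUp ρ = termUp (σ ∘ ρ) :=
  scons_ext rfl fun _ => rfl

theorem Term.subst_rename (P : Term) : ∀ (ρ : ℕ → ℕ) (σ : ℕ → Term),
    (P.rename ρ).subst σ = P.subst (σ ∘ ρ) := by
  induction P with
  | nabs P ih => intro ρ σ; simp only [Term.rename, Term.subst, ih]; rfl
  | _ => intro ρ σ; simp_all [Term.rename, Term.subst, termUp_comp_renUp]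

theorem Term.shift_rename (P : Term) (ρ : ℕ → ℕ) :
    P.shift.rename (renUp ρ) = (P.rename ρ).shift := by
  simp only [Term.shift, Term.rename_rename]; rfl

theorem rename_termUp (ρ : ℕ → ℕ) (σ : ℕ → Term) :
    (fun i => (termUp σ i).rename (renUp ρ)) = termUp fun i => (σ i).rename ρ :=
  scons_ext rfl fun i => Term.shift_rename (σ i) ρ

theorem Term.rename_subst (P : Term) : ∀ (σ : ℕ → Term) (ρ : ℕ → ℕ),
    (P.subst σ).rename ρ = P.subst fun i => (σ i).rename ρ := by
  induction P <;> intro ρ σ <;>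
    simp_all [Term.rename, Term.subst, rename_termUp, Term.nshift, Term.rename_nsubst]

theorem Term.nshift_nsubst (P : Term) (ν : ℕ → Name) :
    P.nshift.nsubst (nameUp ν) = (P.nsubst ν).nshift := by
  simp only [Term.nshift, Term.nsubst_nsubst]; rfl

theorem nsubst_termUp (ν : ℕ → Name) (σ : ℕ → Term) :
    (fun i => (termUp σ i).nsubst ν) = termUp fun i => (σ i).nsubst ν :=
  scons_ext rfl fun i => Term.rename_nsubst (σ i) _ ν

theorem Term.nsubst_subst (P : Term) : ∀ (σ : ℕ → Term) (ν : ℕ → Name),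
    (P.subst σ).nsubst ν = (P.nsubst ν).subst fun i => (σ i).nsubst ν := by
  induction P <;> intro ρ σ <;>
    simp_all [Term.nsubst, Term.subst, nsubst_termUp, Term.nshift_nsubst]

theorem Term.shift_subst (P : Term) (σ : ℕ → Term) :
    P.shift.subst (termUp σ) = (P.subst σ).shift := by
  simp only [Term.shift, Term.subst_rename, Term.rename_subst]; rfl

theorem subst_termUp (σ τ : ℕ → Term) :
    (fun i => (termUp σ i).subst (termUp τ)) = termUp fun i => (σ i).subst τ :=
  scons_ext rfl fun i => Term.shift_subst (σ i) τ

theorem Term.nshift_subst (P : Term) (σ : ℕ → Term) :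
    P.nshift.subst (fun i => (σ i).nshift) = (P.subst σ).nshift := by
  simp only [Term.nshift, Term.nsubst_subst]

theorem Term.subst_subst (P : Term) : ∀ σ τ : ℕ → Term,
    (P.subst σ).subst τ = P.subst fun i => (σ i).subst τ := by
  induction P <;> intro ρ σ <;> simp_all [Term.subst, subst_termUp, Term.nshift_subst]

theorem termUp_var : termUp .var = .var := scons_ext rfl fun _ => rfl

theorem Term.subst_var (P : Term) : P.subst .var = P := by
  induction P <;> simp_all [Term.subst, termUp_var, Term.nshift, Term.nsubst]

theorem Term.shift_inst (P Q : Term) : P.shift.inst Q = P := by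
  rw [Term.shift, Term.inst, Term.subst_rename]
  exact P.subst_var

theorem Term.subst_inst (P Q : Term) (σ : ℕ → Term) :
    (P.subst (termUp σ)).inst Q = P.subst (scons Q σ) := by
  rw [Term.inst, Term.subst_subst]
  congr 1
  exact scons_ext rfl fun i => Term.shift_inst (σ i) Q

theorem Term.inst_subst (P Q : Term) (σ : ℕ → Term) :
    (P.inst Q).subst σ = (P.subst (termUp σ)).inst (Q.subst σ) := by
  rw [Term.subst_inst, Term.inst, Term.subst_subst]
  congr 1
  exact scons_ext rfl fun i => rfl

theorem Term.inst_rename (P Q : Term) (ρ : ℕ → ℕ) :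
    (P.inst Q).rename ρ = (P.rename (renUp ρ)).inst (Q.rename ρ) := by
  rw [Term.inst, Term.inst, Term.rename_subst, Term.subst_rename]
  congr 1
  exact scons_ext rfl fun i => rfl

theorem Term.inst_nsubst (P Q : Term) (ν : ℕ → Name) :
    (P.inst Q).nsubst ν = (P.nsubst ν).inst (Q.nsubst ν) := by
  rw [Term.inst, Term.inst, Term.nsubst_subst]
  congr 1
  exact scons_ext rfl fun i => rfl

theorem Term.nshift_ninst (P : Term) (n : Name) : P.nshift.ninst n = P := by
  rw [Term.nshift, Term.ninst, Term.nsubst_nsubst]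
  exact P.nsubst_var

theorem Term.ninst_subst (P : Term) (n : Name) (σ : ℕ → Term) :
    (P.ninst n).subst σ = (P.subst fun i => (σ i).nshift).ninst n := by
  -- Writing every `σ i` as an instance of its own weakening makes the left side an instance of
  -- `Term.nsubst_subst`.
  have h : σ = fun i => (σ i).nshift.ninst n := by
    funext i
    rw [Term.nshift_ninst]
  conv_lhs => rw [h]
  rw [Term.ninst, Term.ninst, Term.nsubst_subst]
  rfl

theorem Term.ninst_rename (P : Term) (n : Name) (ρ : ℕ → ℕ) :
    (P.ninst n).rename ρ = (P.rename ρ).ninst n :=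
  (P.rename_nsubst ρ _).symm

theorem Name.nsubst_nameUp_scons (ν : ℕ → Name) (n : Name) :
    (fun i => (nameUp ν i).subst (scons n .var)) = scons n ν := by
  refine scons_ext rfl fun i => ?_
  simp only [nameUp, scons_succ, Name.subst_subst]
  exact Name.subst_var _

theorem Term.nsubst_ninst (P : Term) (n : Name) (ν : ℕ → Name) :
    (P.nsubst (nameUp ν)).ninst n = P.nsubst (scons n ν) := by
  rw [Term.ninst, Term.nsubst_nsubst, Name.nsubst_nameUp_scons]

theorem Term.ninst_nsubst (P : Term) (n : Name) (ν : ℕ → Name) :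
    (P.ninst n).nsubst ν = (P.nsubst (nameUp ν)).ninst (n.subst ν) := by
  rw [Term.nsubst_ninst, Term.ninst, Term.nsubst_nsubst]
  congr 1
  exact scons_ext rfl fun i => rfl

/-! ### Superdevelopments -/

/-- Parallel reduction by superdevelopments: applications to abstractions are carried out and
empty components are erased, including those that only arise during the reduction. -/
inductive Dev : Term → Term → Prop
  | nil : Dev .nil .nil
  | var (i) : Dev (.var i) (.var i)
  | inp (m) {P P'} : Dev P P' → Dev (.inp m P) (.inp m P')
  | out (m) {P P'} : Dev P P' → Dev (.out m P) (.out m P')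
  | par {P P' Q Q'} : Dev P P' → Dev Q Q' → Dev (.par P Q) (.par P' Q')
  | pabs {P P'} : Dev P P' → Dev (.pabs P) (.pabs P')
  | papp {P P' Q Q'} : Dev P P' → Dev Q Q' → Dev (.papp P Q) (.papp P' Q')
  | nabs {P P'} : Dev P P' → Dev (.nabs P) (.nabs P')
  | napp {P P'} (n) : Dev P P' → Dev (.napp P n) (.napp P' n)
  | beta {F P Q Q'} : Dev F (.pabs P) → Dev Q Q' → Dev (.papp F Q) (P.inst Q')
  | nbeta {F P} (n) : Dev F (.nabs P) → Dev (.napp F n) (P.ninst n)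
  | nilR {P P' Q} : Dev P P' → Dev Q .nil → Dev (.par P Q) P'
  | nilL {P Q Q'} : Dev P .nil → Dev Q Q' → Dev (.par P Q) Q'

theorem Dev.refl (P : Term) : Dev P P := by
  induction P <;> constructor <;> assumption

theorem Dev.scong {P Q : Term} (h : Dev P Q) : SCong P Q := by
  induction h with
  | nil => exact .refl _
  | var i => exact .refl _
  | inp m _ ih => exact .inp m ih
  | out m _ ih => exact .out m ih
  | par _ _ ih₁ ih₂ => exact .par ih₁ ih₂
  | pabs _ ih => exact .pabs ih
  | papp _ _ ih₁ ih₂ => exact .papp ih₁ ih₂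
  | nabs _ ih => exact .nabs ih
  | napp n _ ih => exact .napp n ih
  | beta _ _ ih₁ ih₂ => exact (SCong.papp ih₁ ih₂).trans (.papp_pabs _ _)
  | nbeta n _ ih => exact (SCong.napp n ih).trans (.napp_nabs _ _)
  | nilR _ _ ih₁ ih₂ => exact (SCong.par ih₁ ih₂).trans (.par_nil _)
  | nilL _ _ ih₁ ih₂ =>
    exact ((SCong.par ih₁ ih₂).trans (.par_comm _ _)).trans (.par_nil _)

theorem Dev.rename {P Q : Term} (h : Dev P Q) : ∀ ρ, Dev (P.rename ρ) (Q.rename ρ) := by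
  induction h with
  | nil => exact fun ρ => .nil
  | var i => exact fun ρ => .var _
  | inp m _ ih => exact fun ρ => .inp m (ih _)
  | out m _ ih => exact fun ρ => .out m (ih _)
  | par _ _ ih₁ ih₂ => exact fun ρ => .par (ih₁ _) (ih₂ _)
  | pabs _ ih => exact fun ρ => .pabs (ih _)
  | papp _ _ ih₁ ih₂ => exact fun ρ => .papp (ih₁ _) (ih₂ _)
  | nabs _ ih => exact fun ρ => .nabs (ih _)
  | napp n _ ih => exact fun ρ => .napp n (ih _)
  | beta _ _ ih₁ ih₂ =>
    intro ρ
    rw [Term.inst_rename]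
    exact .beta (ih₁ ρ) (ih₂ ρ)
  | nbeta n _ ih =>
    intro ρ
    rw [Term.ninst_rename]
    exact .nbeta n (ih ρ)
  | nilR _ _ ih₁ ih₂ => exact fun ρ => .nilR (ih₁ _) (ih₂ ρ)
  | nilL _ _ ih₁ ih₂ => exact fun ρ => .nilL (ih₁ ρ) (ih₂ _)

theorem Dev.nsubst {P Q : Term} (h : Dev P Q) : ∀ ν, Dev (P.nsubst ν) (Q.nsubst ν) := by
  induction h with
  | nil => exact fun ν => .nil
  | var i => exact fun ν => .var _
  | inp m _ ih => exact fun ν => .inp _ (ih _)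
  | out m _ ih => exact fun ν => .out _ (ih _)
  | par _ _ ih₁ ih₂ => exact fun ν => .par (ih₁ _) (ih₂ _)
  | pabs _ ih => exact fun ν => .pabs (ih _)
  | papp _ _ ih₁ ih₂ => exact fun ν => .papp (ih₁ _) (ih₂ _)
  | nabs _ ih => exact fun ν => .nabs (ih _)
  | napp n _ ih => exact fun ν => .napp _ (ih _)
  | beta _ _ ih₁ ih₂ =>
    intro ν
    rw [Term.inst_nsubst]
    exact .beta (ih₁ ν) (ih₂ ν)
  | nbeta n _ ih =>
    intro ν
    rw [Term.ninst_nsubst]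
    exact .nbeta _ (ih ν)
  | nilR _ _ ih₁ ih₂ => exact fun ν => .nilR (ih₁ _) (ih₂ ν)
  | nilL _ _ ih₁ ih₂ => exact fun ν => .nilL (ih₁ ν) (ih₂ _)

theorem Dev.termUp {σ τ : ℕ → Term} (h : ∀ i, Dev (σ i) (τ i)) (i : ℕ) :
    Dev (termUp σ i) (termUp τ i) := by
  cases i with
  | zero => exact .var 0
  | succ i => exact (h i).rename _

theorem Dev.subst {P Q : Term} (h : Dev P Q) : ∀ {σ τ : ℕ → Term}, (∀ i, Dev (σ i) (τ i)) →
    Dev (P.subst σ) (Q.subst τ) := by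
  induction h with
  | nil => exact fun _ => .nil
  | var i => exact fun hσ => hσ i
  | inp m _ ih => exact fun hσ => .inp m (ih (Dev.termUp hσ))
  | out m _ ih => exact fun hσ => .out m (ih hσ)
  | par _ _ ih₁ ih₂ => exact fun hσ => .par (ih₁ hσ) (ih₂ hσ)
  | pabs _ ih => exact fun hσ => .pabs (ih (Dev.termUp hσ))
  | papp _ _ ih₁ ih₂ => exact fun hσ => .papp (ih₁ hσ) (ih₂ hσ)
  | nabs _ ih => exact fun hσ => .nabs (ih fun i => (hσ i).nsubst _)
  | napp n _ ih => exact fun hσ => .napp n (ih hσ)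
  | beta _ _ ih₁ ih₂ =>
    intro σ τ hσ
    rw [Term.inst_subst]
    exact .beta (ih₁ hσ) (ih₂ hσ)
  | nbeta n _ ih =>
    intro σ τ hσ
    rw [Term.ninst_subst]
    exact .nbeta n (ih hσ)
  | nilR _ _ ih₁ ih₂ => exact fun hσ => .nilR (ih₁ hσ) (ih₂ hσ)
  | nilL _ _ ih₁ ih₂ => exact fun hσ => .nilL (ih₁ hσ) (ih₂ hσ)

theorem Dev.inst {P P' Q Q' : Term} (hP : Dev P P') (hQ : Dev Q Q') :
    Dev (P.inst Q) (P'.inst Q') :=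
  hP.subst fun i => by cases i with
    | zero => exact hQ
    | succ i => exact .var i

/-- Parallel composition that erases empty components. -/
def Term.mkPar : Term → Term → Term
  | .nil, Q => Q
  | P, .nil => P
  | P, Q => .par P Q

/-- Application to a term, carried out if possible. -/
def Term.mkPapp : Term → Term → Term
  | .pabs P, Q => P.inst Q
  | P, Q => .papp P Q

/-- Application to a name, carried out if possible. -/
def Term.mkNapp : Term → Name → Term
  | .nabs P, n => P.ninst n
  | P, n => .napp P n

/-- The complete superdevelopment. -/
def Term.full : Term → Term
  | .nil => .nil
  | .var i => .var i
  | .inp m P => .inp m P.full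
  | .out m P => .out m P.full
  | .par P Q => P.full.mkPar Q.full
  | .pabs P => .pabs P.full
  | .papp P Q => P.full.mkPapp Q.full
  | .nabs P => .nabs P.full
  | .napp P n => P.full.mkNapp n

theorem Term.mkPar_nil (P : Term) : P.mkPar .nil = P := by cases P <;> rfl

theorem Dev.mkPar {P P' Q Q' : Term} (hP : Dev P P') (hQ : Dev Q Q') :
    Dev (.par P Q) (P'.mkPar Q') := by
  unfold Term.mkPar
  split
  · exact .nilL hP hQ
  · exact .nilR hP hQ
  · exact .par hP hQ

theorem Dev.mkPapp {P P' Q Q' : Term} (hP : Dev P P') (hQ : Dev Q Q') :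
    Dev (.papp P Q) (P'.mkPapp Q') := by
  unfold Term.mkPapp
  split
  · exact .beta hP hQ
  · exact .papp hP hQ

theorem Dev.mkNapp {P P' : Term} (hP : Dev P P') (n : Name) : Dev (.napp P n) (P'.mkNapp n) := by
  unfold Term.mkNapp
  split
  · exact .nbeta n hP
  · exact .napp n hP

/-- The triangle property, from which the diamond property is immediate. In the contraction cases
the induction hypothesis develops an abstraction (or `nil`), so the complete development of that
part has the same outermost constructor and contracts too. -/
theorem Dev.full {P Q : Term} (h : Dev P Q) : Dev Q P.full := by
  induction h with
  | nil => exact .nil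
  | var i => exact .var i
  | inp m _ ih => exact .inp m ih
  | out m _ ih => exact .out m ih
  | par _ _ ih₁ ih₂ => exact ih₁.mkPar ih₂
  | pabs _ ih => exact .pabs ih
  | papp _ _ ih₁ ih₂ => exact ih₁.mkPapp ih₂
  | nabs _ ih => exact .nabs ih
  | napp n _ ih => exact ih.mkNapp n
  | beta _ _ ih₁ ih₂ =>
    rw [Term.full]
    generalize Term.full _ = F at ih₁
    cases ih₁ with
    | pabs h => exact h.inst ih₂
  | nbeta n _ ih =>
    rw [Term.full]
    generalize Term.full _ = F at ih
    cases ih with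
    | nabs h => exact h.nsubst _
  | nilR _ _ ih₁ ih₂ =>
    rw [Term.full]
    generalize Term.full _ = F at ih₂
    cases ih₂
    rwa [Term.mkPar_nil]
  | nilL _ _ ih₁ ih₂ =>
    rw [Term.full]
    generalize Term.full _ = F at ih₁
    cases ih₁
    exact ih₂

/-- Iterated superdevelopments. -/
abbrev Devs : Term → Term → Prop := Relation.ReflTransGen Dev

theorem Devs.scong {P Q : Term} (h : Devs P Q) : SCong P Q := by
  induction h with
  | refl => exact .refl _
  | tail _ h ih => exact ih.trans h.scong

theorem Devs.confluent {P Q R : Term} (hQ : Devs P Q) (hR : Devs P R) :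
    ∃ S, Devs Q S ∧ Devs R S :=
  Relation.church_rosser
    (fun a _ _ hb hc => ⟨a.full, .single hb.full, .single hc.full⟩) hQ hR

/-! ### Associativity and commutativity -/

/-- The congruence generated by associativity and commutativity of parallel composition. -/
inductive AC : Term → Term → Prop
  | refl (P) : AC P P
  | trans {P Q R} : AC P Q → AC Q R → AC P R
  | inp (m) {P P'} : AC P P' → AC (.inp m P) (.inp m P')
  | out (m) {P P'} : AC P P' → AC (.out m P) (.out m P')
  | par {P P' Q Q'} : AC P P' → AC Q Q' → AC (.par P Q) (.par P' Q')
  | pabs {P P'} : AC P P' → AC (.pabs P) (.pabs P')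
  | papp {P P' Q Q'} : AC P P' → AC Q Q' → AC (.papp P Q) (.papp P' Q')
  | nabs {P P'} : AC P P' → AC (.nabs P) (.nabs P')
  | napp {P P'} (n) : AC P P' → AC (.napp P n) (.napp P' n)
  | assoc (P Q R) : AC (.par (.par P Q) R) (.par P (.par Q R))
  | assoc' (P Q R) : AC (.par P (.par Q R)) (.par (.par P Q) R)
  | comm (P Q) : AC (.par P Q) (.par Q P)

theorem AC.symm {P Q : Term} (h : AC P Q) : AC Q P := by
  induction h with
  | refl P => exact .refl P
  | trans _ _ ih₁ ih₂ => exact ih₂.trans ih₁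
  | inp m _ ih => exact .inp m ih
  | out m _ ih => exact .out m ih
  | par _ _ ih₁ ih₂ => exact .par ih₁ ih₂
  | pabs _ ih => exact .pabs ih
  | papp _ _ ih₁ ih₂ => exact .papp ih₁ ih₂
  | nabs _ ih => exact .nabs ih
  | napp n _ ih => exact .napp n ih
  | assoc P Q R => exact .assoc' P Q R
  | assoc' P Q R => exact .assoc P Q R
  | comm P Q => exact .comm Q P

theorem AC.scong {P Q : Term} (h : AC P Q) : SCong P Q := by
  induction h with
  | refl P => exact .refl P
  | trans _ _ ih₁ ih₂ => exact ih₁.trans ih₂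
  | inp m _ ih => exact .inp m ih
  | out m _ ih => exact .out m ih
  | par _ _ ih₁ ih₂ => exact .par ih₁ ih₂
  | pabs _ ih => exact .pabs ih
  | papp _ _ ih₁ ih₂ => exact .papp ih₁ ih₂
  | nabs _ ih => exact .nabs ih
  | napp n _ ih => exact .napp n ih
  | assoc P Q R => exact .par_assoc P Q R
  | assoc' P Q R => exact (SCong.par_assoc P Q R).symm
  | comm P Q => exact .par_comm P Q

theorem AC.rename {P Q : Term} (h : AC P Q) : ∀ ρ, AC (P.rename ρ) (Q.rename ρ) := by
  induction h with
  | refl P => exact fun ρ => .refl _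
  | trans _ _ ih₁ ih₂ => exact fun ρ => (ih₁ ρ).trans (ih₂ ρ)
  | inp m _ ih => exact fun ρ => .inp m (ih _)
  | out m _ ih => exact fun ρ => .out m (ih _)
  | par _ _ ih₁ ih₂ => exact fun ρ => .par (ih₁ _) (ih₂ _)
  | pabs _ ih => exact fun ρ => .pabs (ih _)
  | papp _ _ ih₁ ih₂ => exact fun ρ => .papp (ih₁ _) (ih₂ _)
  | nabs _ ih => exact fun ρ => .nabs (ih _)
  | napp n _ ih => exact fun ρ => .napp n (ih _)
  | assoc P Q R => exact fun ρ => .assoc _ _ _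
  | assoc' P Q R => exact fun ρ => .assoc' _ _ _
  | comm P Q => exact fun ρ => .comm _ _

theorem AC.nsubst {P Q : Term} (h : AC P Q) : ∀ ν, AC (P.nsubst ν) (Q.nsubst ν) := by
  induction h with
  | refl P => exact fun ν => .refl _
  | trans _ _ ih₁ ih₂ => exact fun ν => (ih₁ ν).trans (ih₂ ν)
  | inp m _ ih => exact fun ν => .inp _ (ih _)
  | out m _ ih => exact fun ν => .out _ (ih _)
  | par _ _ ih₁ ih₂ => exact fun ν => .par (ih₁ _) (ih₂ _)
  | pabs _ ih => exact fun ν => .pabs (ih _)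
  | papp _ _ ih₁ ih₂ => exact fun ν => .papp (ih₁ _) (ih₂ _)
  | nabs _ ih => exact fun ν => .nabs (ih _)
  | napp n _ ih => exact fun ν => .napp _ (ih _)
  | assoc P Q R => exact fun ν => .assoc _ _ _
  | assoc' P Q R => exact fun ν => .assoc' _ _ _
  | comm P Q => exact fun ν => .comm _ _

theorem AC.subst {P Q : Term} (h : AC P Q) : ∀ σ, AC (P.subst σ) (Q.subst σ) := by
  induction h with
  | refl P => exact fun σ => .refl _
  | trans _ _ ih₁ ih₂ => exact fun σ => (ih₁ σ).trans (ih₂ σ)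
  | inp m _ ih => exact fun σ => .inp m (ih _)
  | out m _ ih => exact fun σ => .out m (ih _)
  | par _ _ ih₁ ih₂ => exact fun σ => .par (ih₁ _) (ih₂ _)
  | pabs _ ih => exact fun σ => .pabs (ih _)
  | papp _ _ ih₁ ih₂ => exact fun σ => .papp (ih₁ _) (ih₂ _)
  | nabs _ ih => exact fun σ => .nabs (ih _)
  | napp n _ ih => exact fun σ => .napp n (ih _)
  | assoc P Q R => exact fun σ => .assoc _ _ _
  | assoc' P Q R => exact fun σ => .assoc' _ _ _
  | comm P Q => exact fun σ => .comm _ _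

theorem AC.termUp {σ τ : ℕ → Term} (h : ∀ i, AC (σ i) (τ i)) (i : ℕ) :
    AC (termUp σ i) (termUp τ i) := by
  cases i with
  | zero => exact .refl _
  | succ i => exact (h i).rename _

theorem AC.subst_right (P : Term) : ∀ {σ τ : ℕ → Term}, (∀ i, AC (σ i) (τ i)) →
    AC (P.subst σ) (P.subst τ) := by
  induction P with
  | nil => exact fun _ => .refl _
  | var i => exact fun h => h i
  | inp m P ih => exact fun h => .inp m (ih (AC.termUp h))
  | out m P ih => exact fun h => .out m (ih h)
  | par P Q ih₁ ih₂ => exact fun h => .par (ih₁ h) (ih₂ h)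
  | pabs P ih => exact fun h => .pabs (ih (AC.termUp h))
  | papp P Q ih₁ ih₂ => exact fun h => .papp (ih₁ h) (ih₂ h)
  | nabs P ih => exact fun h => .nabs (ih fun i => (h i).nsubst _)
  | napp P n ih => exact fun h => .napp n (ih h)

theorem AC.inst {P P' Q Q' : Term} (hP : AC P P') (hQ : AC Q Q') :
    AC (P.inst Q) (P'.inst Q') :=
  (hP.subst _).trans <| .subst_right _ fun i => by cases i with
    | zero => exact hQ
    | succ i => exact .refl _

/-- Terms with the same outermost constructor, whose arguments agree up to `AC` unless that
constructor is parallel composition. -/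
def Term.ACLike : Term → Term → Prop
  | .nil, Y => Y = .nil
  | .var i, Y => Y = .var i
  | .inp m P, Y => ∃ P', Y = .inp m P' ∧ AC P P'
  | .out m P, Y => ∃ P', Y = .out m P' ∧ AC P P'
  | .par _ _, Y => ∃ P' Q', Y = .par P' Q'
  | .pabs P, Y => ∃ P', Y = .pabs P' ∧ AC P P'
  | .papp P Q, Y => ∃ P' Q', Y = .papp P' Q' ∧ AC P P' ∧ AC Q Q'
  | .nabs P, Y => ∃ P', Y = .nabs P' ∧ AC P P'
  | .napp P n, Y => ∃ P', Y = .napp P' n ∧ AC P P'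

/-- Serves as inversion for `AC`, where case analysis is blocked by the transitivity constructor. -/
theorem AC.like {P Q : Term} (h : AC P Q) : P.ACLike Q := by
  induction h with
  | refl P => cases P <;> simp [Term.ACLike, AC.refl]
  | @trans P Q R _ _ ih₁ ih₂ =>
    cases P <;> simp only [Term.ACLike] at ih₁ ⊢
    case nil => subst ih₁; exact ih₂
    case var => subst ih₁; exact ih₂
    case par =>
      obtain ⟨_, _, rfl⟩ := ih₁
      exact ih₂
    case papp =>
      obtain ⟨_, _, rfl, h₁, h₂⟩ := ih₁
      obtain ⟨_, _, rfl, h₃, h₄⟩ := ih₂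
      exact ⟨_, _, rfl, h₁.trans h₃, h₂.trans h₄⟩
    all_goals
      obtain ⟨_, rfl, h₁⟩ := ih₁
      obtain ⟨_, rfl, h₂⟩ := ih₂
      exact ⟨_, rfl, h₁.trans h₂⟩
  | inp m h => exact ⟨_, rfl, h⟩
  | out m h => exact ⟨_, rfl, h⟩
  | par _ _ => exact ⟨_, _, rfl⟩
  | pabs h => exact ⟨_, rfl, h⟩
  | papp h₁ h₂ => exact ⟨_, _, rfl, h₁, h₂⟩
  | nabs h => exact ⟨_, rfl, h⟩
  | napp n h => exact ⟨_, rfl, h⟩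
  | assoc P Q R => exact ⟨_, _, rfl⟩
  | assoc' P Q R => exact ⟨_, _, rfl⟩
  | comm P Q => exact ⟨_, _, rfl⟩

/-- One step is answered by one step because `Dev` also erases components that become empty only
during the step: when several of `P`, `Q`, `R` vanish, either bracketing can erase them all at once.
-/
theorem AC.dev {P Q : Term} (h : AC P Q) : ∀ {P'}, Dev P P' → ∃ Q', Dev Q Q' ∧ AC P' Q' := by
  induction h with
  | refl P => exact fun h => ⟨_, h, .refl _⟩
  | trans _ _ ih₁ ih₂ =>
    intro P' h
    obtain ⟨_, h₁, a₁⟩ := ih₁ h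
    obtain ⟨_, h₂, a₂⟩ := ih₂ h₁
    exact ⟨_, h₂, a₁.trans a₂⟩
  | inp m _ ih =>
    intro P' h
    cases h with
    | inp _ h =>
      obtain ⟨_, h, a⟩ := ih h
      exact ⟨_, .inp m h, .inp m a⟩
  | out m _ ih =>
    intro P' h
    cases h with
    | out _ h =>
      obtain ⟨_, h, a⟩ := ih h
      exact ⟨_, .out m h, .out m a⟩
  | par _ _ ih₁ ih₂ =>
    intro P' h
    cases h with
    | par h₁ h₂ =>
      obtain ⟨_, h₁, a₁⟩ := ih₁ h₁
      obtain ⟨_, h₂, a₂⟩ := ih₂ h₂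
      exact ⟨_, .par h₁ h₂, .par a₁ a₂⟩
    | nilR h₁ h₂ =>
      obtain ⟨_, h₁, a₁⟩ := ih₁ h₁
      obtain ⟨_, h₂, a₂⟩ := ih₂ h₂
      obtain rfl := a₂.like
      exact ⟨_, .nilR h₁ h₂, a₁⟩
    | nilL h₁ h₂ =>
      obtain ⟨_, h₁, a₁⟩ := ih₁ h₁
      obtain ⟨_, h₂, a₂⟩ := ih₂ h₂
      obtain rfl := a₁.like
      exact ⟨_, .nilL h₁ h₂, a₂⟩
  | pabs _ ih =>
    intro P' h
    cases h with
    | pabs h =>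
      obtain ⟨_, h, a⟩ := ih h
      exact ⟨_, .pabs h, .pabs a⟩
  | papp _ _ ih₁ ih₂ =>
    intro P' h
    cases h with
    | papp h₁ h₂ =>
      obtain ⟨_, h₁, a₁⟩ := ih₁ h₁
      obtain ⟨_, h₂, a₂⟩ := ih₂ h₂
      exact ⟨_, .papp h₁ h₂, .papp a₁ a₂⟩
    | beta h₁ h₂ =>
      obtain ⟨_, h₁, a₁⟩ := ih₁ h₁
      obtain ⟨_, h₂, a₂⟩ := ih₂ h₂
      obtain ⟨_, rfl, a⟩ := a₁.like
      exact ⟨_, .beta h₁ h₂, a.inst a₂⟩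
  | nabs _ ih =>
    intro P' h
    cases h with
    | nabs h =>
      obtain ⟨_, h, a⟩ := ih h
      exact ⟨_, .nabs h, .nabs a⟩
  | napp n _ ih =>
    intro P' h
    cases h with
    | napp _ h =>
      obtain ⟨_, h, a⟩ := ih h
      exact ⟨_, .napp n h, .napp n a⟩
    | nbeta _ h =>
      obtain ⟨_, h, a⟩ := ih h
      obtain ⟨_, rfl, a'⟩ := a.like
      exact ⟨_, .nbeta n h, a'.nsubst _⟩
  | assoc P Q R =>
    intro X h
    cases h with
    | par h hR =>
      cases h with
      | par hP hQ => exact ⟨_, .par hP (.par hQ hR), .assoc _ _ _⟩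
      | nilR hP hQ => exact ⟨_, .par hP (.nilL hQ hR), .refl _⟩
      | nilL hP hQ => exact ⟨_, .nilL hP (.par hQ hR), .refl _⟩
    | nilR h hR =>
      cases h with
      | par hP hQ => exact ⟨_, .par hP (.nilR hQ hR), .refl _⟩
      | nilR hP hQ => exact ⟨_, .nilR hP (.nilL hQ hR), .refl _⟩
      | nilL hP hQ => exact ⟨_, .nilL hP (.nilR hQ hR), .refl _⟩
    | nilL h hR =>
      cases h with
      | nilR hP hQ => exact ⟨_, .nilL hP (.nilL hQ hR), .refl _⟩
      | nilL hP hQ => exact ⟨_, .nilL hP (.nilL hQ hR), .refl _⟩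
  | assoc' P Q R =>
    intro X h
    cases h with
    | par hP h =>
      cases h with
      | par hQ hR => exact ⟨_, .par (.par hP hQ) hR, .assoc' _ _ _⟩
      | nilR hQ hR => exact ⟨_, .nilR (.par hP hQ) hR, .refl _⟩
      | nilL hQ hR => exact ⟨_, .par (.nilR hP hQ) hR, .refl _⟩
    | nilR hP h =>
      cases h with
      | nilR hQ hR => exact ⟨_, .nilR (.nilR hP hQ) hR, .refl _⟩
      | nilL hQ hR => exact ⟨_, .nilR (.nilR hP hQ) hR, .refl _⟩
    | nilL hP h =>
      cases h with
      | par hQ hR => exact ⟨_, .par (.nilL hP hQ) hR, .refl _⟩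
      | nilR hQ hR => exact ⟨_, .nilR (.nilL hP hQ) hR, .refl _⟩
      | nilL hQ hR => exact ⟨_, .nilL (.nilL hP hQ) hR, .refl _⟩
  | comm P Q =>
    intro X h
    cases h with
    | par h₁ h₂ => exact ⟨_, .par h₂ h₁, .comm _ _⟩
    | nilR h₁ h₂ => exact ⟨_, .nilL h₂ h₁, .refl _⟩
    | nilL h₁ h₂ => exact ⟨_, .nilR h₂ h₁, .refl _⟩

theorem AC.devs {P Q P' : Term} (a : AC P Q) (h : Devs P P') : ∃ Q', Devs Q Q' ∧ AC P' Q' := by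
  induction h with
  | refl => exact ⟨_, .refl, a⟩
  | tail _ h ih =>
    obtain ⟨_, h₁, a₁⟩ := ih
    obtain ⟨_, h₂, a₂⟩ := a₁.dev h
    exact ⟨_, h₁.tail h₂, a₂⟩

/-! ### The Church–Rosser property -/

/-- Having reducts that agree up to associativity and commutativity. -/
def Joinable (P Q : Term) : Prop := ∃ P' Q', Devs P P' ∧ Devs Q Q' ∧ AC P' Q'

/-- Confluence joins the two reducts of `Q`; the reductions used are then carried across the two
`AC` equivalences to the outer terms. -/
theorem Joinable.trans {P Q R : Term} (h₁ : Joinable P Q) (h₂ : Joinable Q R) : Joinable P R := by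
  obtain ⟨P₁, Q₁, hP, hQ₁, a₁⟩ := h₁
  obtain ⟨Q₂, R₂, hQ₂, hR, a₂⟩ := h₂
  obtain ⟨S, hS₁, hS₂⟩ := hQ₁.confluent hQ₂
  obtain ⟨P₃, hP₃, a₃⟩ := a₁.symm.devs hS₁
  obtain ⟨R₃, hR₃, a₄⟩ := a₂.devs hS₂
  exact ⟨P₃, R₃, hP.trans hP₃, hR.trans hR₃, a₃.symm.trans a₄⟩

theorem Joinable.of_dev {P Q : Term} (h : Dev P Q) : Joinable P Q :=
  ⟨Q, Q, .single h, .refl, .refl Q⟩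

theorem Joinable.of_ac {P Q : Term} (h : AC P Q) : Joinable P Q := ⟨P, Q, .refl, .refl, h⟩

theorem Joinable.congr {f : Term → Term} (hd : ∀ {P Q}, Dev P Q → Dev (f P) (f Q))
    (ha : ∀ {P Q}, AC P Q → AC (f P) (f Q)) {P Q : Term} (h : Joinable P Q) :
    Joinable (f P) (f Q) := by
  obtain ⟨P', Q', hP, hQ, a⟩ := h
  exact ⟨f P', f Q', hP.lift f fun _ _ => hd, hQ.lift f fun _ _ => hd, ha a⟩

theorem SCong.joinable {P Q : Term} (h : SCong P Q) : Joinable P Q := by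
  induction h with
  | refl P => exact .of_ac (.refl P)
  | symm _ ih =>
    obtain ⟨P', Q', hP, hQ, a⟩ := ih
    exact ⟨Q', P', hQ, hP, a.symm⟩
  | trans _ _ ih₁ ih₂ => exact ih₁.trans ih₂
  | inp m _ ih => exact ih.congr (.inp m) (.inp m)
  | out m _ ih => exact ih.congr (.out m) (.out m)
  | @par _ P' Q _ _ _ ih₁ ih₂ =>
    exact (ih₁.congr (f := (Term.par · Q)) (Dev.par · (.refl _)) (AC.par · (.refl _))).trans
      (ih₂.congr (f := Term.par P') (.par (.refl _)) (.par (.refl _)))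
  | pabs _ ih => exact ih.congr .pabs .pabs
  | @papp _ P' Q _ _ _ ih₁ ih₂ =>
    exact (ih₁.congr (f := (Term.papp · Q)) (Dev.papp · (.refl _)) (AC.papp · (.refl _))).trans
      (ih₂.congr (f := Term.papp P') (.papp (.refl _)) (.papp (.refl _)))
  | nabs _ ih => exact ih.congr .nabs .nabs
  | napp n _ ih => exact ih.congr (f := (Term.napp · n)) (.napp n) (.napp n)
  | par_assoc P Q R => exact .of_ac (.assoc P Q R)
  | par_comm P Q => exact .of_ac (.comm P Q)
  | par_nil P => exact .of_dev (.nilR (.refl P) .nil)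
  | papp_pabs P Q => exact .of_dev (.beta (.refl _) (.refl _))
  | napp_nabs P m => exact .of_dev (.nbeta m (.refl _))

theorem SCong.rename {P Q : Term} (h : SCong P Q) (ρ : ℕ → ℕ) :
    SCong (P.rename ρ) (Q.rename ρ) := by
  obtain ⟨P', Q', hP, hQ, a⟩ := h.joinable
  have h₁ : Devs (P.rename ρ) (P'.rename ρ) := hP.lift (Term.rename ρ) fun _ _ h => h.rename ρ
  have h₂ : Devs (Q.rename ρ) (Q'.rename ρ) := hQ.lift (Term.rename ρ) fun _ _ h => h.rename ρ
  exact (h₁.scong.trans (a.rename ρ).scong).trans h₂.scong.symm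

/-! ### Parallel components -/

/-- The nonempty parallel components of a term. -/
def Term.comps : Term → Multiset Term
  | .nil => 0
  | .par P Q => P.comps + Q.comps
  | P => {P}

/-- A parallel composition of the members of a multiset. -/
noncomputable def parMultiset (M : Multiset Term) : Term := M.toList.foldr .par .nil

theorem SCong.foldr_par {l l' : List Term} (h : l.Perm l') :
    SCong (l.foldr .par .nil) (l'.foldr .par .nil) := by
  induction h with
  | nil => exact .refl _
  | cons _ _ ih => exact .par (.refl _) ih
  | swap a b l =>
    exact ((SCong.par_assoc _ _ _).symm.trans (.par (.par_comm _ _) (.refl _))).trans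
      (.par_assoc _ _ _)
  | trans _ _ ih₁ ih₂ => exact ih₁.trans ih₂

/-- `Multiset.toList` chooses an arbitrary order, which `≡` cannot see. -/
theorem parMultiset_coe (l : List Term) :
    SCong (parMultiset l) (l.foldr .par .nil) :=
  .foldr_par <| Multiset.coe_eq_coe.1 (Multiset.coe_toList _)

theorem parMultiset_zero : SCong (parMultiset 0) .nil := parMultiset_coe []

theorem parMultiset_cons (a : Term) (M : Multiset Term) :
    SCong (parMultiset (a ::ₘ M)) (.par a (parMultiset M)) := by
  induction M using Quotient.inductionOn with
  | h l => exact (parMultiset_coe (a :: l)).trans (.par (.refl _) (parMultiset_coe l).symm)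

theorem SCong.nil_par (P : Term) : SCong (.par .nil P) P := (SCong.par_comm _ _).trans (.par_nil _)

theorem parMultiset_singleton (P : Term) : SCong (parMultiset {P}) P :=
  ((parMultiset_cons P 0).trans (.par (.refl _) parMultiset_zero)).trans (.par_nil P)

theorem parMultiset_add (M N : Multiset Term) :
    SCong (parMultiset (M + N)) (.par (parMultiset M) (parMultiset N)) := by
  induction M using Multiset.induction with
  | empty =>
    rw [zero_add]
    exact ((SCong.par parMultiset_zero (.refl _)).trans (.nil_par _)).symm
  | cons a M ih =>
    rw [Multiset.cons_add]
    exact (((parMultiset_cons _ _).trans (.par (.refl _) ih)).trans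
      (SCong.par_assoc _ _ _).symm).trans (.par (parMultiset_cons _ _).symm (.refl _))

theorem parMultiset_rel {M N : Multiset Term} (h : Multiset.Rel SCong M N) :
    SCong (parMultiset M) (parMultiset N) := by
  induction h with
  | zero => exact .refl _
  | cons h _ ih =>
    exact ((parMultiset_cons _ _).trans (.par h ih)).trans (parMultiset_cons _ _).symm

theorem parMultiset_comps (P : Term) : SCong (parMultiset P.comps) P := by
  induction P with
  | nil => exact parMultiset_zero
  | par P Q ih₁ ih₂ => exact (parMultiset_add _ _).trans (.par ih₁ ih₂)
  | _ => exact parMultiset_singleton _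

theorem scong_of_comps_eq_cons {P C : Term} {M : Multiset Term} (h : P.comps = C ::ₘ M) :
    SCong P (.par C (parMultiset M)) :=
  (parMultiset_comps P).symm.trans (h ▸ parMultiset_cons C M)

theorem Term.comps_rename (P : Term) (ρ : ℕ → ℕ) :
    (P.rename ρ).comps = P.comps.map (Term.rename ρ) := by
  induction P <;> simp_all [Term.rename, Term.comps]

theorem parMultiset_rename (M : Multiset Term) (ρ : ℕ → ℕ) :
    SCong (parMultiset (M.map (Term.rename ρ))) ((parMultiset M).rename ρ) := by
  induction M using Multiset.induction with
  | empty => exact parMultiset_zero.trans (parMultiset_zero.rename ρ).symm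
  | cons a M ih =>
    rw [Multiset.map_cons]
    exact ((parMultiset_cons _ _).trans (.par (.refl _) ih)).trans
      ((parMultiset_cons a M).rename ρ).symm

theorem multiset_rel_refl {r : Term → Term → Prop} (hr : ∀ P, r P P) (M : Multiset Term) :
    Multiset.Rel r M M :=
  Multiset.rel_refl_of_refl_on fun P _ => hr P

theorem AC.comps {P Q : Term} (h : AC P Q) : Multiset.Rel AC P.comps Q.comps := by
  have single {P Q : Term} (h : AC P Q) : Multiset.Rel AC {P} {Q} := .cons h .zero
  induction h with
  | refl P => exact multiset_rel_refl .refl _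
  | trans _ _ ih₁ ih₂ =>
    have : IsTrans Term AC := ⟨fun _ _ _ => .trans⟩
    exact ih₁.trans _ ih₂
  | par _ _ ih₁ ih₂ => exact ih₁.add ih₂
  | assoc P Q R =>
    simp only [Term.comps, add_assoc]
    exact multiset_rel_refl .refl _
  | assoc' P Q R =>
    simp only [Term.comps, add_assoc]
    exact multiset_rel_refl .refl _
  | comm P Q =>
    simp only [Term.comps, add_comm]
    exact multiset_rel_refl .refl _
  | inp m h => exact single (.inp m h)
  | out m h => exact single (.out m h)
  | pabs h => exact single (.pabs h)
  | papp h₁ h₂ => exact single (.papp h₁ h₂)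
  | nabs h => exact single (.nabs h)
  | napp n h => exact single (.napp n h)

theorem Devs.par_inv {P R X : Term} (h : Devs (.par P R) X) :
    ∃ P' R', Devs P P' ∧ Devs R R' ∧ X.comps = P'.comps + R'.comps := by
  -- The equation of multisets is too weak as an induction hypothesis: the next step must be
  -- inverted, which requires the shape of `X`. Either the composition is still there or one side
  -- has been erased.
  suffices ∃ P' R', Devs P P' ∧ Devs R R' ∧
      (X = .par P' R' ∨ X = P' ∧ R' = .nil ∨ X = R' ∧ P' = .nil) by
    obtain ⟨P', R', hP, hR, rfl | ⟨rfl, rfl⟩ | ⟨rfl, rfl⟩⟩ := this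
    · exact ⟨_, _, hP, hR, rfl⟩
    · exact ⟨_, _, hP, hR, (add_zero _).symm⟩
    · exact ⟨_, _, hP, hR, (zero_add _).symm⟩
  induction h with
  | refl => exact ⟨P, R, .refl, .refl, .inl rfl⟩
  | tail _ h ih =>
    obtain ⟨P', R', hP, hR, rfl | ⟨rfl, rfl⟩ | ⟨rfl, rfl⟩⟩ := ih
    · cases h with
      | par h₁ h₂ => exact ⟨_, _, hP.tail h₁, hR.tail h₂, .inl rfl⟩
      | nilR h₁ h₂ => exact ⟨_, _, hP.tail h₁, hR.tail h₂, .inr (.inl ⟨rfl, rfl⟩)⟩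
      | nilL h₁ h₂ => exact ⟨_, _, hP.tail h₁, hR.tail h₂, .inr (.inr ⟨rfl, rfl⟩)⟩
    · exact ⟨_, _, hP.tail h, hR, .inr (.inl ⟨rfl, rfl⟩)⟩
    · exact ⟨_, _, hP, hR.tail h, .inr (.inr ⟨rfl, rfl⟩)⟩

/-! ### Rigid components -/

/-- Neutral terms, i.e. variables applied to arguments, that agree up to structural congruence
of the arguments. -/
inductive NeutralMatch : Term → Term → Prop
  | var (i) : NeutralMatch (.var i) (.var i)
  | papp {P P' A A'} : NeutralMatch P P' → SCong A A' → NeutralMatch (.papp P A) (.papp P' A')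
  | napp {P P'} (n) : NeutralMatch P P' → NeutralMatch (.napp P n) (.napp P' n)

/-- Prefixes or neutral terms that agree up to structural congruence of their immediate
constituents. -/
inductive Match : Term → Term → Prop
  | inp (m) {P P'} : SCong P P' → Match (.inp m P) (.inp m P')
  | out (m) {P P'} : SCong P P' → Match (.out m P) (.out m P')
  | neutral {P P'} : NeutralMatch P P' → Match P P'

theorem NeutralMatch.scong {P Q : Term} (h : NeutralMatch P Q) : SCong P Q := by
  induction h with
  | var i => exact .refl _
  | papp _ h ih => exact .papp ih h
  | napp n _ ih => exact .napp n ih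

theorem Match.scong {P Q : Term} (h : Match P Q) : SCong P Q := by
  cases h with
  | inp m h => exact .inp m h
  | out m h => exact .out m h
  | neutral h => exact h.scong

/-- The head of the spine is a variable and never turns into an abstraction, so no application along
the spine can be contracted and only arguments change. -/
theorem NeutralMatch.dev {C P : Term} (h : NeutralMatch C P) :
    ∀ {P'}, Dev P P' → NeutralMatch C P' := by
  induction h with
  | var i =>
    intro P' h
    cases h
    exact .var i
  | papp _ h ih =>
    intro P' hd
    cases hd with
    | papp h₁ h₂ => exact .papp (ih h₁) (h.trans h₂.scong)
    | beta h₁ h₂ => cases ih h₁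
  | napp n _ ih =>
    intro P' hd
    cases hd with
    | napp _ h => exact .napp n (ih h)
    | nbeta _ h => cases ih h

theorem NeutralMatch.ac {C P : Term} (h : NeutralMatch C P) :
    ∀ {P'}, AC P P' → NeutralMatch C P' := by
  induction h with
  | var i =>
    intro P' h
    obtain rfl := h.like
    exact .var i
  | papp _ h ih =>
    intro P' hd
    obtain ⟨_, _, rfl, h₁, h₂⟩ := hd.like
    exact .papp (ih h₁) (h.trans h₂.scong)
  | napp n _ ih =>
    intro P' hd
    obtain ⟨_, rfl, h₁⟩ := hd.like
    exact .napp n (ih h₁)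

theorem Match.dev {C P P' : Term} (h : Match C P) (hd : Dev P P') : Match C P' := by
  cases h with
  | inp m h =>
    cases hd with
    | inp _ hd => exact .inp m (h.trans hd.scong)
  | out m h =>
    cases hd with
    | out _ hd => exact .out m (h.trans hd.scong)
  | neutral h => exact .neutral (h.dev hd)

theorem NeutralMatch.devs {C P P' : Term} (h : NeutralMatch C P) (hd : Devs P P') :
    NeutralMatch C P' := by
  induction hd with
  | refl => exact h
  | tail _ hd ih => exact ih.dev hd

theorem Match.devs {C P P' : Term} (h : Match C P) (hd : Devs P P') : Match C P' := by
  induction hd with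
  | refl => exact h
  | tail _ hd ih => exact ih.dev hd

theorem Match.ac {C P P' : Term} (h : Match C P) (ha : AC P P') : Match C P' := by
  cases h with
  | inp m h =>
    obtain ⟨_, rfl, h'⟩ := ha.like
    exact .inp m (h.trans h'.scong)
  | out m h =>
    obtain ⟨_, rfl, h'⟩ := ha.like
    exact .out m (h.trans h'.scong)
  | neutral h => exact .neutral (h.ac ha)

theorem NeutralMatch.comps {C P : Term} (h : NeutralMatch C P) : P.comps = {P} := by
  cases h <;> rfl

theorem Match.comps {C P : Term} (h : Match C P) : P.comps = {P} := by
  cases h with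
  | neutral h => exact h.comps
  | _ => rfl

/-- A rigid component of a term up to structural congruence is a component of a reduct. -/
theorem exists_devs_of_scong_par {P C S : Term} (hC : Match C C) (h : SCong P (.par C S)) :
    ∃ P' C' M, Devs P P' ∧ P'.comps = C' ::ₘ M ∧ Match C C' ∧ SCong S (parMultiset M) := by
  obtain ⟨P', Y, hP, hY, a⟩ := h.joinable
  obtain ⟨C₁, S₁, hC₁, hS, e⟩ := hY.par_inv
  -- The reduct of `C` is still rigid, hence a single component; its `AC` partner is then a single
  -- component of `P'`.
  have hm := hC.devs hC₁
  have r := a.comps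
  rw [e, hm.comps, Multiset.singleton_add, Multiset.rel_cons_right] at r
  obtain ⟨C', M, hC', hM, e'⟩ := r
  refine ⟨P', C', M, hP, e', hm.ac hC'.symm, ?_⟩
  refine (hS.scong.trans (parMultiset_comps S₁).symm).trans (parMultiset_rel ?_).symm
  exact hM.mono fun _ _ _ _ h => h.scong

/-- A rigid component of a parallel composition belongs to one of the two sides. -/
theorem SCong.par_split {P R C S : Term} (hC : Match C C)
    (h : SCong (.par P R) (.par C S)) :
    (∃ P₂, SCong P (.par C P₂) ∧ SCong S (.par P₂ R)) ∨
      ∃ R₂, SCong R (.par C R₂) ∧ SCong S (.par P R₂) := by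
  obtain ⟨X, C', M, hX, e, hm, hS⟩ := exists_devs_of_scong_par hC h
  obtain ⟨P', R', hP, hR, e'⟩ := hX.par_inv
  -- Components of a reduct of `P | R` are those of a reduct of `P` together with those of a reduct
  -- of `R`, so `C'` lies in one of the two; the rest is reassembled up to `≡`.
  have hmem : C' ∈ P'.comps + R'.comps := by rw [← e', e]; exact Multiset.mem_cons_self _ _
  rw [Multiset.mem_add] at hmem
  rcases hmem with hmem | hmem
  · obtain ⟨N, hN⟩ := Multiset.exists_cons_of_mem hmem
    rw [e, hN, Multiset.cons_add, Multiset.cons_inj_right] at e'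
    subst e'
    refine .inl ⟨parMultiset N, ?_, ?_⟩
    · exact (hP.scong.trans (scong_of_comps_eq_cons hN)).trans (.par hm.scong.symm (.refl _))
    · exact (hS.trans (parMultiset_add _ _)).trans
        (.par (.refl _) ((parMultiset_comps R').trans hR.scong.symm))
  · obtain ⟨N, hN⟩ := Multiset.exists_cons_of_mem hmem
    rw [e, hN, Multiset.add_cons, Multiset.cons_inj_right] at e'
    subst e'
    refine .inr ⟨parMultiset N, ?_, ?_⟩
    · exact (hR.scong.trans (scong_of_comps_eq_cons hN)).trans (.par hm.scong.symm (.refl _))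
    · exact (hS.trans (parMultiset_add _ _)).trans
        (.par ((parMultiset_comps P').trans hP.scong.symm) (.refl _))

/-! ### Reflection along renamings -/

/-- Renaming replaces variables by variables, so outermost constructors agree and no redex or empty
component is created, even when `ρ` identifies variables. -/
theorem Dev.of_rename {P : Term} : ∀ {ρ : ℕ → ℕ} {X : Term}, Dev (P.rename ρ) X →
    ∃ P', Dev P P' ∧ X = P'.rename ρ := by
  induction P with
  | nil =>
    intro ρ X h
    cases h
    exact ⟨_, .nil, rfl⟩
  | var i =>
    intro ρ X h
    cases h
    exact ⟨_, .var i, rfl⟩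
  | inp m P ih =>
    intro ρ X h
    cases h with
    | inp _ h =>
      obtain ⟨_, d, rfl⟩ := ih h
      exact ⟨_, .inp m d, rfl⟩
  | out m P ih =>
    intro ρ X h
    cases h with
    | out _ h =>
      obtain ⟨_, d, rfl⟩ := ih h
      exact ⟨_, .out m d, rfl⟩
  | par P Q ih₁ ih₂ =>
    intro ρ X h
    cases h with
    | par h₁ h₂ =>
      obtain ⟨_, d₁, rfl⟩ := ih₁ h₁
      obtain ⟨_, d₂, rfl⟩ := ih₂ h₂
      exact ⟨_, .par d₁ d₂, rfl⟩
    | nilR h₁ h₂ =>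
      obtain ⟨_, d₁, rfl⟩ := ih₁ h₁
      obtain ⟨Q', d₂, e⟩ := ih₂ h₂
      cases Q' <;> cases e
      exact ⟨_, .nilR d₁ d₂, rfl⟩
    | nilL h₁ h₂ =>
      obtain ⟨P', d₁, e⟩ := ih₁ h₁
      obtain ⟨_, d₂, rfl⟩ := ih₂ h₂
      cases P' <;> cases e
      exact ⟨_, .nilL d₁ d₂, rfl⟩
  | pabs P ih =>
    intro ρ X h
    cases h with
    | pabs h =>
      obtain ⟨_, d, rfl⟩ := ih h
      exact ⟨_, .pabs d, rfl⟩
  | papp P Q ih₁ ih₂ =>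
    intro ρ X h
    cases h with
    | papp h₁ h₂ =>
      obtain ⟨_, d₁, rfl⟩ := ih₁ h₁
      obtain ⟨_, d₂, rfl⟩ := ih₂ h₂
      exact ⟨_, .papp d₁ d₂, rfl⟩
    | beta h₁ h₂ =>
      obtain ⟨P', d₁, e⟩ := ih₁ h₁
      obtain ⟨_, d₂, rfl⟩ := ih₂ h₂
      cases P' <;> cases e
      exact ⟨_, .beta d₁ d₂, (Term.inst_rename _ _ _).symm⟩
  | nabs P ih =>
    intro ρ X h
    cases h with
    | nabs h =>
      obtain ⟨_, d, rfl⟩ := ih h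
      exact ⟨_, .nabs d, rfl⟩
  | napp P n ih =>
    intro ρ X h
    cases h with
    | napp _ h =>
      obtain ⟨_, d, rfl⟩ := ih h
      exact ⟨_, .napp n d, rfl⟩
    | nbeta _ h =>
      obtain ⟨P', d, e⟩ := ih h
      cases P' <;> cases e
      exact ⟨_, .nbeta n d, (Term.ninst_rename _ _ _).symm⟩

theorem Devs.of_rename {P X : Term} {ρ : ℕ → ℕ} (h : Devs (P.rename ρ) X) :
    ∃ P', Devs P P' ∧ X = P'.rename ρ := by
  induction h with
  | refl => exact ⟨P, .refl, rfl⟩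
  | tail _ h ih =>
    obtain ⟨P', hP, rfl⟩ := ih
    obtain ⟨P'', d, rfl⟩ := h.of_rename
    exact ⟨P'', hP.tail d, rfl⟩

theorem SCong.split_of_rename {P C S : Term} {ρ : ℕ → ℕ} (hC : Match C C)
    (h : SCong (P.rename ρ) (.par C S)) :
    ∃ C' P₂, SCong P (.par C' P₂) ∧ Match C (C'.rename ρ) ∧ SCong S (P₂.rename ρ) := by
  obtain ⟨X, C', M, hX, e, hm, hS⟩ := exists_devs_of_scong_par hC h
  obtain ⟨P', hP, rfl⟩ := hX.of_rename
  have hmem : C' ∈ P'.comps.map (Term.rename ρ) := by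
    rw [← Term.comps_rename, e]
    exact Multiset.mem_cons_self _ _
  obtain ⟨C₀, h₀, rfl⟩ := Multiset.mem_map.1 hmem
  obtain ⟨N, hN⟩ := Multiset.exists_cons_of_mem h₀
  rw [Term.comps_rename, hN, Multiset.map_cons, Multiset.cons_inj_right] at e
  subst e
  exact ⟨C₀, parMultiset N, hP.scong.trans (scong_of_comps_eq_cons hN), hm,
    hS.trans (parMultiset_rename N ρ)⟩

theorem SCong.pabs_of_rename {P A : Term} {ρ : ℕ → ℕ} (h : SCong (P.rename ρ) (.pabs A)) :
    ∃ A', SCong P (.pabs A') ∧ SCong A (A'.rename (renUp ρ)) := by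
  obtain ⟨X, Y, hX, hY, a⟩ := h.joinable
  obtain ⟨P', hP, rfl⟩ := hX.of_rename
  have hY' : ∃ A', Y = .pabs A' ∧ SCong A A' := by
    clear a
    induction hY with
    | refl => exact ⟨A, rfl, .refl A⟩
    | tail _ hd ih =>
      obtain ⟨A', rfl, hA⟩ := ih
      cases hd with
      | pabs hd => exact ⟨_, rfl, hA.trans hd.scong⟩
  obtain ⟨A', rfl, hA⟩ := hY'
  obtain ⟨A'', e, hA''⟩ := a.symm.like
  cases P' <;> cases e
  exact ⟨_, hP.scong, hA.trans hA''.scong⟩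

theorem SCong.nabs_of_rename {P A : Term} {ρ : ℕ → ℕ} (h : SCong (P.rename ρ) (.nabs A)) :
    ∃ A', SCong P (.nabs A') ∧ SCong A (A'.rename ρ) := by
  obtain ⟨X, Y, hX, hY, a⟩ := h.joinable
  obtain ⟨P', hP, rfl⟩ := hX.of_rename
  have hY' : ∃ A', Y = .nabs A' ∧ SCong A A' := by
    clear a
    induction hY with
    | refl => exact ⟨A, rfl, .refl A⟩
    | tail _ hd ih =>
      obtain ⟨A', rfl, hA⟩ := ih
      cases hd with
      | nabs hd => exact ⟨_, rfl, hA.trans hd.scong⟩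
  obtain ⟨A', rfl, hA⟩ := hY'
  obtain ⟨A'', e, hA''⟩ := a.symm.like
  cases P' <;> cases e
  exact ⟨_, hP.scong, hA.trans hA''.scong⟩

/-! ### Transitions in terms of structural congruence -/

theorem SCong.shift {P Q : Term} (h : SCong P Q) : SCong P.shift Q.shift := h.rename _

theorem SCong.par_left_comm (P Q R : Term) :
    SCong (.par P (.par Q R)) (.par Q (.par P R)) :=
  ((SCong.par_assoc _ _ _).symm.trans (.par (.par_comm _ _) (.refl _))).trans (.par_assoc _ _ _)

/-- With `Trans.of_inp` and the two output lemmas, this reduces visible transitions to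
decompositions up to `≡`, so all clauses of bisimulation can be treated by tracing components. -/
theorem Trans.inp_inv {P P' : Term} {m : Name} (h : Trans P (.inp m) P') :
    ∃ P₁ P₂, SCong P (.par (.inp m P₁) P₂) ∧ SCong P' (.par P₁ P₂.shift) := by
  generalize e : Act.inp m = l at h
  induction h with
  | inp m P =>
    cases e
    exact ⟨P, .nil, (SCong.par_nil _).symm, (SCong.par_nil _).symm⟩
  | out m Q => cases e
  | parL Q _ ih =>
    subst e
    obtain ⟨P₁, P₂, h₁, h₂⟩ := ih rfl
    exact ⟨P₁, .par P₂ Q, (SCong.par h₁ (.refl _)).trans (.par_assoc _ _ _),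
      (SCong.par h₂ (.refl _)).trans (.par_assoc _ _ _)⟩
  | parR Q _ ih =>
    subst e
    obtain ⟨P₁, P₂, h₁, h₂⟩ := ih rfl
    exact ⟨P₁, .par Q P₂, (SCong.par (.refl _) h₁).trans (.par_left_comm _ _ _),
      (SCong.par (.refl _) h₂).trans (.par_left_comm _ _ _)⟩
  | comL => cases e
  | comR => cases e
  | struct h₁ _ h₂ ih =>
    obtain ⟨P₁, P₂, h₃, h₄⟩ := ih e
    exact ⟨P₁, P₂, h₁.trans h₃, h₂.symm.trans h₄⟩

theorem Trans.of_inp {P P₁ P₂ : Term} {m : Name} (h : SCong P (.par (.inp m P₁) P₂)) :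
    Trans P (.inp m) (.par P₁ P₂.shift) :=
  .struct h (.parL P₂ (.inp m P₁)) (.refl _)

theorem Trans.out_inv {P P' A : Term} {m : Name} (h : Trans P (.out m A) P') :
    SCong P (.par (.out m A) P') := by
  generalize e : Act.out m A = l at h
  induction h with
  | inp m P => cases e
  | out m Q =>
    cases e
    exact (SCong.par_nil _).symm
  | parL Q _ ih =>
    subst e
    exact (SCong.par (ih rfl) (.refl _)).trans (.par_assoc _ _ _)
  | parR Q _ ih =>
    subst e
    exact (SCong.par (.refl _) (ih rfl)).trans (.par_left_comm _ _ _)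
  | comL => cases e
  | comR => cases e
  | struct h₁ _ h₂ ih => exact (h₁.trans (ih e)).trans (.par (.refl _) h₂)

theorem Trans.of_out {P P' A : Term} {m : Name} (h : SCong P (.par (.out m A) P')) :
    Trans P (.out m A) P' :=
  .struct h (.parL P' (.out m A)) (.nil_par _)

/-! ### Bisimulations in terms of observable components -/

/-- The observable components other than inputs, with their payloads removed. -/
inductive Head : Type
  | out (m : Name)
  | var (i : ℕ)
  | papp (i : ℕ)
  | napp (i : ℕ) (d : Name)

/-- The component with a given payload. -/
def Head.fill : Head → Term → Term
  | .out m, A => .out m A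
  | .var i, _ => .var i
  | .papp i, A => .papp (.var i) A
  | .napp i d, _ => .napp (.var i) d

/-- Lifting of a relation to payloads. -/
def Head.Payload : Head → (Term → Term → Prop) → Term → Term → Prop
  | .out _, R, A, B => R A B
  | .papp _, R, A, B => R A B
  | _, _, _, _ => True

theorem Head.fill_match (h : Head) (A : Term) : Match (h.fill A) (h.fill A) := by
  cases h with
  | out m => exact .out m (.refl A)
  | var i => exact .neutral (.var i)
  | papp i => exact .neutral (.papp (.var i) (.refl A))
  | napp i d => exact .neutral (.napp d (.var i))

theorem Head.Payload.mono {h : Head} {R S : Term → Term → Prop} {A B : Term}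
    (hR : h.Payload R A B) (hRS : ∀ {A B}, R A B → S A B) : h.Payload S A B := by
  cases h <;> first | exact hRS hR | trivial

theorem Head.Payload.of_refl (h : Head) {R : Term → Term → Prop} (hR : ∀ A, R A A) (A : Term) :
    h.Payload R A A := by
  cases h <;> first | exact hR A | trivial

theorem Head.Payload.comp {h : Head} {R S T : Term → Term → Prop} {A B C : Term}
    (hR : h.Payload R A B) (hS : h.Payload S B C) (hT : ∀ {A B C}, R A B → S B C → T A C) :
    h.Payload T A C := by
  cases h <;> first | exact hT hR hS | trivial

/-- `Q` matches the observations of `P` up to `R`. -/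
structure Simulates (R : Term → Term → Prop) (P Q : Term) : Prop where
  nonAbs : ¬ IsAbstraction P → ¬ IsAbstraction Q
  pabs : ∀ A, SCong P (.pabs A) → ∃ B, SCong Q (.pabs B) ∧ R A B
  nabs : ∀ A, SCong P (.nabs A) → ∃ B, SCong Q (.nabs B) ∧ R A B
  head : ∀ (h : Head) A P', SCong P (.par (h.fill A) P') →
    ∃ B Q', SCong Q (.par (h.fill B) Q') ∧ h.Payload R A B ∧ R P' Q'
  inp : ∀ m P₁ P₂, SCong P (.par (.inp m P₁) P₂) →
    ∃ Q₁ Q₂, SCong Q (.par (.inp m Q₁) Q₂) ∧ R (.par P₁ P₂.shift) (.par Q₁ Q₂.shift)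

/-- Closure of a relation under structural congruence on both sides. -/
def SCongClosure (R : Term → Term → Prop) (P Q : Term) : Prop :=
  ∃ P' Q', SCong P P' ∧ R P' Q' ∧ SCong Q' Q

theorem SCongClosure.of {R : Term → Term → Prop} {P Q : Term} (h : R P Q) : SCongClosure R P Q :=
  ⟨P, Q, .refl P, h, .refl Q⟩

theorem IsAbstraction.scong {P Q : Term} (h : SCong P Q) (hP : IsAbstraction P) :
    IsAbstraction Q := by
  obtain ⟨A, hA⟩ | ⟨A, hA⟩ := hP
  · exact .inl ⟨A, h.symm.trans hA⟩
  · exact .inr ⟨A, h.symm.trans hA⟩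

theorem Simulates.scong {R : Term → Term → Prop} {P P' Q Q' : Term} (h : Simulates R P' Q')
    (hP : SCong P P') (hQ : SCong Q' Q) : Simulates R P Q where
  nonAbs hn hQ' := h.nonAbs (fun h' => hn (h'.scong hP.symm)) (hQ'.scong hQ.symm)
  pabs A hA := by
    obtain ⟨B, hB, r⟩ := h.pabs A (hP.symm.trans hA)
    exact ⟨B, hQ.symm.trans hB, r⟩
  nabs A hA := by
    obtain ⟨B, hB, r⟩ := h.nabs A (hP.symm.trans hA)
    exact ⟨B, hQ.symm.trans hB, r⟩
  head hd A P₂ hA := by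
    obtain ⟨B, Q₂, hB, r⟩ := h.head hd A P₂ (hP.symm.trans hA)
    exact ⟨B, Q₂, hQ.symm.trans hB, r⟩
  inp m P₁ P₂ hA := by
    obtain ⟨Q₁, Q₂, hB, r⟩ := h.inp m P₁ P₂ (hP.symm.trans hA)
    exact ⟨Q₁, Q₂, hQ.symm.trans hB, r⟩

/-- A symmetric relation that is a bisimulation up to structural congruence lies in
bisimilarity. -/
theorem Bisim.coinduct {R : Term → Term → Prop} (hs : ∀ {P Q}, R P Q → R Q P)
    (hR : ∀ {P Q}, R P Q → Simulates (SCongClosure R) P Q) {P Q : Term}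
    (h : SCongClosure R P Q) : Bisim P Q := by
  have key {P Q : Term} (h : SCongClosure R P Q) : Simulates (SCongClosure R) P Q := by
    obtain ⟨P', Q', hP, h, hQ⟩ := h
    exact (hR h).scong hP hQ
  refine ⟨SCongClosure R, ?_, h⟩
  constructor
  · rintro P Q ⟨P', Q', hP, h, hQ⟩
    exact ⟨Q', P', hQ.symm, hs h, hP.symm⟩
  · exact fun h => (key h).nonAbs
  · exact fun h => (key h).pabs
  · exact fun h => (key h).nabs
  · intro P Q h m A P' ht
    obtain ⟨B, Q', hQ, hAB, r⟩ := (key h).head (.out m) A P' ht.out_inv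
    exact ⟨B, Q', .of_out hQ, hAB, r⟩
  · intro P Q h m P' ht
    obtain ⟨P₁, P₂, h₁, h₂⟩ := ht.inp_inv
    obtain ⟨Q₁, Q₂, hQ, P₃, Q₃, h₃, r, h₄⟩ := (key h).inp m P₁ P₂ h₁
    exact ⟨_, .of_inp hQ, P₃, Q₃, h₂.trans h₃, r, h₄⟩
  · intro P Q h i P' hP
    -- The payload `.nil` is a dummy, ignored by `Head.fill` for this kind of head.
    obtain ⟨_, Q', hQ, _, r⟩ := (key h).head (.var i) .nil P' hP
    exact ⟨Q', hQ, r⟩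
  · intro P Q h i A P' hP
    obtain ⟨B, Q', hQ, hAB, r⟩ := (key h).head (.papp i) A P' hP
    exact ⟨B, Q', hQ, hAB, r⟩
  · intro P Q h i d P' hP
    obtain ⟨_, Q', hQ, _, r⟩ := (key h).head (.napp i d) .nil P' hP
    exact ⟨Q', hQ, r⟩

theorem Bisim.symm {P Q : Term} (h : Bisim P Q) : Bisim Q P := by
  obtain ⟨R, hR, h⟩ := h
  exact ⟨R, hR, hR.symm h⟩

theorem Bisim.of_scong {P Q : Term} (h : SCong P Q) : Bisim P Q := by
  refine Bisim.coinduct (R := SCong) .symm (fun {P Q} h => ?_) (.of h)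
  exact
    { nonAbs := fun hn hQ => hn (hQ.scong h.symm)
      pabs := fun A hA => ⟨A, h.symm.trans hA, .of (.refl A)⟩
      nabs := fun A hA => ⟨A, h.symm.trans hA, .of (.refl A)⟩
      head := fun hd A P' hP =>
        ⟨A, P', h.symm.trans hP, .of_refl hd (fun A => .of (.refl A)) A, .of (.refl P')⟩
      inp := fun m P₁ P₂ hP => ⟨P₁, P₂, h.symm.trans hP, .of (.refl _)⟩ }

theorem Simulates.mono {R S : Term → Term → Prop} {P Q : Term} (h : Simulates R P Q)
    (hRS : ∀ {A B}, R A B → S A B) : Simulates S P Q where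
  nonAbs := h.nonAbs
  pabs A hA := by
    obtain ⟨B, hB, r⟩ := h.pabs A hA
    exact ⟨B, hB, hRS r⟩
  nabs A hA := by
    obtain ⟨B, hB, r⟩ := h.nabs A hA
    exact ⟨B, hB, hRS r⟩
  head hd A P' hA := by
    obtain ⟨B, Q', hB, hAB, r⟩ := h.head hd A P' hA
    exact ⟨B, Q', hB, hAB.mono hRS, hRS r⟩
  inp m P₁ P₂ hA := by
    obtain ⟨Q₁, Q₂, hB, r⟩ := h.inp m P₁ P₂ hA
    exact ⟨Q₁, Q₂, hB, hRS r⟩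

/-- The closure is needed because the target of a matching input is only congruent to the parallel
composition required by `Simulates`. -/
theorem IsHOIOBisimulation.simulates {R : Term → Term → Prop} (hR : IsHOIOBisimulation R)
    {P Q : Term} (h : R P Q) : Simulates (SCongClosure R) P Q := by
  refine ⟨hR.nonAbs h, ?_, ?_, ?_, ?_⟩
  · intro A hA
    obtain ⟨B, hB, r⟩ := hR.pabs h A hA
    exact ⟨B, hB, .of r⟩
  · intro A hA
    obtain ⟨B, hB, r⟩ := hR.nabs h A hA
    exact ⟨B, hB, .of r⟩
  · intro hd A P' hP
    cases hd with
    | out m =>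
      obtain ⟨B, Q', hB, hAB, r⟩ := hR.out h m A P' (.of_out hP)
      exact ⟨B, Q', hB.out_inv, .of hAB, .of r⟩
    | var i =>
      obtain ⟨Q', hB, r⟩ := hR.var h i P' hP
      exact ⟨A, Q', hB, trivial, .of r⟩
    | papp i =>
      obtain ⟨B, Q', hB, hAB, r⟩ := hR.papp h i A P' hP
      exact ⟨B, Q', hB, .of hAB, .of r⟩
    | napp i d =>
      obtain ⟨Q', hB, r⟩ := hR.napp h i d P' hP
      exact ⟨A, Q', hB, trivial, .of r⟩
  · intro m P₁ P₂ hP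
    obtain ⟨Q', ht, r⟩ := hR.inp h m _ (.of_inp hP)
    obtain ⟨Q₁, Q₂, h₁, h₂⟩ := ht.inp_inv
    exact ⟨Q₁, Q₂, h₁, _, Q', .refl _, r, h₂⟩

theorem Bisim.simulates {P Q : Term} (h : Bisim P Q) : Simulates Bisim P Q := by
  obtain ⟨R, hR, h⟩ := h
  exact (hR.simulates h).mono (Bisim.coinduct hR.symm hR.simulates)

theorem Bisim.trans {P Q R : Term} (h₁ : Bisim P Q) (h₂ : Bisim Q R) : Bisim P R := by
  refine Bisim.coinduct (R := fun P R => ∃ Q, Bisim P Q ∧ Bisim Q R) ?_ ?_ (.of ⟨Q, h₁, h₂⟩)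
  · rintro P R ⟨Q, h₁, h₂⟩
    exact ⟨Q, h₂.symm, h₁.symm⟩
  · rintro P R ⟨Q, h₁, h₂⟩
    refine ⟨fun h => h₂.simulates.nonAbs (h₁.simulates.nonAbs h), ?_, ?_, ?_, ?_⟩
    · intro A hA
      obtain ⟨B, hB, r₁⟩ := h₁.simulates.pabs A hA
      obtain ⟨C, hC, r₂⟩ := h₂.simulates.pabs B hB
      exact ⟨C, hC, .of ⟨B, r₁, r₂⟩⟩
    · intro A hA
      obtain ⟨B, hB, r₁⟩ := h₁.simulates.nabs A hA
      obtain ⟨C, hC, r₂⟩ := h₂.simulates.nabs B hB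
      exact ⟨C, hC, .of ⟨B, r₁, r₂⟩⟩
    · intro hd A P' hP
      obtain ⟨B, Q', hQ, p₁, r₁⟩ := h₁.simulates.head hd A P' hP
      obtain ⟨C, R', hR, p₂, r₂⟩ := h₂.simulates.head hd B Q' hQ
      exact ⟨C, R', hR, p₁.comp p₂ fun r₁ r₂ => .of ⟨_, r₁, r₂⟩, .of ⟨Q', r₁, r₂⟩⟩
    · intro m P₁ P₂ hP
      obtain ⟨Q₁, Q₂, hQ, r₁⟩ := h₁.simulates.inp m P₁ P₂ hP
      obtain ⟨R₁, R₂, hR, r₂⟩ := h₂.simulates.inp m Q₁ Q₂ hQ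
      exact ⟨R₁, R₂, hR, .of ⟨_, r₁, r₂⟩⟩

theorem Bisim.scong {P P' Q Q' : Term} (hP : SCong P P') (h : Bisim P' Q') (hQ : SCong Q' Q) :
    Bisim P Q :=
  ((Bisim.of_scong hP).trans h).trans (.of_scong hQ)

/-! ### Bisimilarity is closed under renaming -/

/-- Renaming of the variable of a head. -/
def Head.rename (ρ : ℕ → ℕ) : Head → Head
  | .out m => .out m
  | .var i => .var (ρ i)
  | .papp i => .papp (ρ i)
  | .napp i d => .napp (ρ i) d

theorem Head.fill_rename (h : Head) (A : Term) (ρ : ℕ → ℕ) :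
    (h.fill A).rename ρ = (h.rename ρ).fill (A.rename ρ) := by
  cases h <;> rfl

theorem Head.exists_of_match_rename {h : Head} {A C : Term} {ρ : ℕ → ℕ}
    (hm : Match (h.fill A) (C.rename ρ)) :
    ∃ h' A', C = Head.fill h' A' ∧ h = h'.rename ρ ∧ h.Payload SCong A (A'.rename ρ) := by
  generalize eX : C.rename ρ = X at hm
  cases h with
  | out m =>
    cases hm with
    | out _ hA =>
      cases C <;> cases eX
      exact ⟨.out m, _, rfl, rfl, hA⟩
    | neutral hn => cases hn
  | var i =>
    cases hm with
    | neutral hn =>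
      cases hn
      cases C <;> cases eX
      exact ⟨.var _, .nil, rfl, rfl, trivial⟩
  | papp i =>
    cases hm with
    | neutral hn =>
      cases hn with
      | papp hn hA =>
        cases hn
        cases C with
        | papp F A' =>
          cases F <;> cases eX
          exact ⟨.papp _, _, rfl, rfl, hA⟩
        | _ => cases eX
  | napp i d =>
    cases hm with
    | neutral hn =>
      cases hn with
      | napp _ hn =>
        cases hn
        cases C with
        | napp F d' =>
          cases F <;> cases eX
          exact ⟨.napp _ _, .nil, rfl, rfl, trivial⟩
        | _ => cases eX

theorem SCong.head_of_rename {P A S : Term} {h : Head} {ρ : ℕ → ℕ}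
    (hP : SCong (P.rename ρ) (.par (h.fill A) S)) :
    ∃ h' A' P₂, SCong P (.par (Head.fill h' A') P₂) ∧ h = h'.rename ρ ∧
      h.Payload SCong A (A'.rename ρ) ∧ SCong S (P₂.rename ρ) := by
  obtain ⟨C, P₂, hC, hm, hS⟩ := hP.split_of_rename (h.fill_match A)
  obtain ⟨h', A', rfl, e, hA⟩ := Head.exists_of_match_rename hm
  exact ⟨h', A', P₂, hC, e, hA, hS⟩

theorem SCong.inp_of_rename {P A S : Term} {m : Name} {ρ : ℕ → ℕ}
    (hP : SCong (P.rename ρ) (.par (.inp m A) S)) :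
    ∃ P₁ P₂, SCong P (.par (.inp m P₁) P₂) ∧ SCong A (P₁.rename (renUp ρ)) ∧
      SCong S (P₂.rename ρ) := by
  obtain ⟨C, P₂, hC, hm, hS⟩ := hP.split_of_rename (.inp m (.refl A))
  generalize eX : C.rename ρ = X at hm
  cases hm with
  | inp _ hA =>
    cases C <;> cases eX
    exact ⟨_, P₂, hC, hA, hS⟩
  | neutral hn => cases hn

theorem IsAbstraction.rename {P : Term} (h : IsAbstraction P) (ρ : ℕ → ℕ) :
    IsAbstraction (P.rename ρ) := by
  obtain ⟨A, hA⟩ | ⟨A, hA⟩ := h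
  · exact .inl ⟨_, hA.rename ρ⟩
  · exact .inr ⟨_, hA.rename ρ⟩

theorem IsAbstraction.of_rename {P : Term} {ρ : ℕ → ℕ} (h : IsAbstraction (P.rename ρ)) :
    IsAbstraction P := by
  obtain ⟨A, hA⟩ | ⟨A, hA⟩ := h
  · obtain ⟨B, hB, _⟩ := hA.pabs_of_rename
    exact .inl ⟨B, hB⟩
  · obtain ⟨B, hB, _⟩ := hA.nabs_of_rename
    exact .inr ⟨B, hB⟩

/-- Every observation of a renamed term is, up to `≡`, the renaming of an observation of the term
itself. Nothing here needs `ρ` injective, and the cancellation argument uses it to merge two input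
variables. -/
theorem Bisim.rename {P Q : Term} (h : Bisim P Q) (ρ : ℕ → ℕ) :
    Bisim (P.rename ρ) (Q.rename ρ) := by
  refine Bisim.coinduct (R := fun P Q => ∃ P₀ Q₀ ρ, Bisim P₀ Q₀ ∧
    P = Term.rename ρ P₀ ∧ Q = Term.rename ρ Q₀) ?_ ?_ (.of ⟨P, Q, ρ, h, rfl, rfl⟩)
  · rintro _ _ ⟨P, Q, ρ, h, rfl, rfl⟩
    exact ⟨Q, P, ρ, h.symm, rfl, rfl⟩
  · rintro _ _ ⟨P, Q, ρ, h, rfl, rfl⟩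
    refine ⟨fun hP hQ => h.simulates.nonAbs (fun hP' => hP (hP'.rename ρ)) hQ.of_rename,
      ?_, ?_, ?_, ?_⟩
    · intro A hA
      obtain ⟨A', hA', e⟩ := hA.pabs_of_rename
      obtain ⟨B, hB, r⟩ := h.simulates.pabs A' hA'
      exact ⟨_, hB.rename ρ, _, _, e, ⟨A', B, _, r, rfl, rfl⟩, .refl _⟩
    · intro A hA
      obtain ⟨A', hA', e⟩ := hA.nabs_of_rename
      obtain ⟨B, hB, r⟩ := h.simulates.nabs A' hA'
      exact ⟨_, hB.rename ρ, _, _, e, ⟨A', B, _, r, rfl, rfl⟩, .refl _⟩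
    · intro hd A S hP
      obtain ⟨hd, A', P₂, hP', rfl, hA, hS⟩ := hP.head_of_rename
      obtain ⟨B, Q₂, hQ, p, r⟩ := h.simulates.head hd A' P₂ hP'
      refine ⟨B.rename ρ, Q₂.rename ρ, ?_, ?_, _, _, hS, ⟨P₂, Q₂, ρ, r, rfl, rfl⟩, .refl _⟩
      · rw [← Head.fill_rename]
        exact hQ.rename ρ
      · cases hd with
        | out m => exact ⟨_, _, hA, ⟨A', B, ρ, p, rfl, rfl⟩, .refl _⟩
        | papp i => exact ⟨_, _, hA, ⟨A', B, ρ, p, rfl, rfl⟩, .refl _⟩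
        | var i => trivial
        | napp i d => trivial
    · intro m A S hP
      obtain ⟨P₁, P₂, hP', hA, hS⟩ := hP.inp_of_rename
      obtain ⟨Q₁, Q₂, hQ, r⟩ := h.simulates.inp m P₁ P₂ hP'
      refine ⟨_, _, hQ.rename ρ, _, _, ?_, ⟨_, _, renUp ρ, r, rfl, rfl⟩, ?_⟩
      · refine .par hA ?_
        rw [Term.shift_rename]
        exact hS.shift
      · refine .par (.refl _) ?_
        rw [Term.shift_rename]
        exact .refl _

/-! ### Subject reduction -/

theorem HasType.rename {Γ : ℕ → Ty} {P : Term} {T : Ty} (h : HasType Γ P T) :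
    ∀ {Δ : ℕ → Ty} {ρ : ℕ → ℕ}, (∀ i, Δ (ρ i) = Γ i) → HasType Δ (P.rename ρ) T := by
  have up {Γ Δ : ℕ → Ty} {ρ : ℕ → ℕ} {S : Ty} (h : ∀ i, Δ (ρ i) = Γ i) (i : ℕ) :
      scons S Δ (renUp ρ i) = scons S Γ i := by
    cases i with
    | zero => rfl
    | succ i => exact h i
  induction h with
  | nil Γ => exact fun _ => .nil _
  | var Γ i => exact fun h => h i ▸ .var _ _
  | inp _ ih => exact fun h => .inp (ih (up h))
  | out _ ih => exact fun h => .out (ih h)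
  | par _ _ ih₁ ih₂ => exact fun h => .par (ih₁ h) (ih₂ h)
  | pabs _ ih => exact fun h => .pabs (ih (up h))
  | papp _ _ ih₁ ih₂ => exact fun h => .papp (ih₁ h) (ih₂ h)
  | nabs _ ih => exact fun h => .nabs (ih h)
  | napp _ ih => exact fun h => .napp (ih h)

theorem HasType.shift {Γ : ℕ → Ty} {P : Term} {T : Ty} (h : HasType Γ P T) (S : Ty) :
    HasType (scons S Γ) P.shift T :=
  h.rename fun _ => rfl

theorem HasType.nsubst {Γ : ℕ → Ty} {P : Term} {T : Ty} (h : HasType Γ P T) :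
    ∀ ν, HasType Γ (P.nsubst ν) T := by
  induction h with
  | nil Γ => exact fun _ => .nil _
  | var Γ i => exact fun _ => .var _ _
  | inp _ ih => exact fun _ => .inp (ih _)
  | out _ ih => exact fun _ => .out (ih _)
  | par _ _ ih₁ ih₂ => exact fun _ => .par (ih₁ _) (ih₂ _)
  | pabs _ ih => exact fun _ => .pabs (ih _)
  | papp _ _ ih₁ ih₂ => exact fun _ => .papp (ih₁ _) (ih₂ _)
  | nabs _ ih => exact fun _ => .nabs (ih _)
  | napp _ ih => exact fun _ => .napp (ih _)

theorem HasType.subst {Γ : ℕ → Ty} {P : Term} {T : Ty} (h : HasType Γ P T) :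
    ∀ {Δ : ℕ → Ty} {σ : ℕ → Term}, (∀ i, HasType Δ (σ i) (Γ i)) → HasType Δ (P.subst σ) T := by
  have up {Γ Δ : ℕ → Ty} {σ : ℕ → Term} {S : Ty} (h : ∀ i, HasType Δ (σ i) (Γ i)) (i : ℕ) :
      HasType (scons S Δ) (termUp σ i) (scons S Γ i) := by
    cases i with
    | zero => exact .var _ 0
    | succ i => exact (h i).shift S
  induction h with
  | nil Γ => exact fun _ => .nil _
  | var Γ i => exact fun h => h i
  | inp _ ih => exact fun h => .inp (ih (up h))
  | out _ ih => exact fun h => .out (ih h)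
  | par _ _ ih₁ ih₂ => exact fun h => .par (ih₁ h) (ih₂ h)
  | pabs _ ih => exact fun h => .pabs (ih (up h))
  | papp _ _ ih₁ ih₂ => exact fun h => .papp (ih₁ h) (ih₂ h)
  | nabs _ ih => exact fun h => .nabs (ih fun i => (h i).nsubst _)
  | napp _ ih => exact fun h => .napp (ih h)

theorem HasType.inst {Γ : ℕ → Ty} {P Q : Term} {S T : Ty} (hP : HasType (scons S Γ) P T)
    (hQ : HasType Γ Q S) : HasType Γ (P.inst Q) T :=
  hP.subst fun i => by cases i with
    | zero => exact hQ
    | succ i => exact .var _ i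

/-- Typing is preserved along reduction only: expanding a term may introduce an ill-typed argument.
This is why `IsProc` asks for a typed term merely up to `≡`. -/
theorem HasType.dev {P Q : Term} (hd : Dev P Q) :
    ∀ {Γ : ℕ → Ty} {T : Ty}, HasType Γ P T → HasType Γ Q T := by
  induction hd with
  | nil => exact fun h => h
  | var i => exact fun h => h
  | inp m _ ih =>
    intro Γ T h
    cases h with
    | inp h => exact .inp (ih h)
  | out m _ ih =>
    intro Γ T h
    cases h with
    | out h => exact .out (ih h)
  | par _ _ ih₁ ih₂ =>
    intro Γ T h
    cases h with
    | par h₁ h₂ => exact .par (ih₁ h₁) (ih₂ h₂)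
  | pabs _ ih =>
    intro Γ T h
    cases h with
    | pabs h => exact .pabs (ih h)
  | papp _ _ ih₁ ih₂ =>
    intro Γ T h
    cases h with
    | papp h₁ h₂ => exact .papp (ih₁ h₁) (ih₂ h₂)
  | nabs _ ih =>
    intro Γ T h
    cases h with
    | nabs h => exact .nabs (ih h)
  | napp n _ ih =>
    intro Γ T h
    cases h with
    | napp h => exact .napp (ih h)
  | beta _ _ ih₁ ih₂ =>
    intro Γ T h
    cases h with
    | papp h₁ h₂ =>
      cases ih₁ h₁ with
      | pabs h => exact h.inst (ih₂ h₂)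
  | nbeta n _ ih =>
    intro Γ T h
    cases h with
    | napp h =>
      cases ih h with
      | nabs h => exact h.nsubst _
  | nilR _ _ ih _ =>
    intro Γ T h
    cases h with
    | par h _ => exact ih h
  | nilL _ _ _ ih =>
    intro Γ T h
    cases h with
    | par _ h => exact ih h

theorem HasType.devs {P Q : Term} {Γ : ℕ → Ty} {T : Ty} (h : HasType Γ P T) (hd : Devs P Q) :
    HasType Γ Q T := by
  induction hd with
  | refl => exact h
  | tail _ hd ih => exact ih.dev hd

theorem HasType.comps {Γ : ℕ → Ty} {P : Term} (h : HasType Γ P .proc) :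
    ∀ C ∈ P.comps, HasType Γ C .proc := by
  induction P with
  | nil => simp [Term.comps]
  | par P Q ih₁ ih₂ =>
    cases h with
    | par h₁ h₂ =>
      intro C hC
      rcases Multiset.mem_add.1 hC with hC | hC
      · exact ih₁ h₁ C hC
      · exact ih₂ h₂ C hC
  | _ => simpa [Term.comps] using h

theorem HasType.parMultiset {Γ : ℕ → Ty} {M : Multiset Term}
    (h : ∀ C ∈ M, HasType Γ C .proc) : HasType Γ (parMultiset M) .proc := by
  have key (l : List Term) (h : ∀ C ∈ l, HasType Γ C .proc) :
      HasType Γ (l.foldr .par .nil) .proc := by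
    induction l with
    | nil => exact .nil Γ
    | cons a l ih =>
      exact .par (h a List.mem_cons_self) (ih fun C hC => h C (List.mem_cons_of_mem a hC))
  exact key _ fun C hC => h C (Multiset.mem_toList.1 hC)

/-- Being a typed non-abstraction, up to structural congruence. -/
def IsProc (P : Term) : Prop := ∃ P₀ Γ, SCong P P₀ ∧ HasType Γ P₀ .proc

/-- The decomposition is traced to a reduct of the typed representative, whose components are typed
by subject reduction. -/
theorem IsProc.split {P C S : Term} (hP : IsProc P) (hC : Match C C)
    (h : SCong P (.par C S)) :
    ∃ Γ C' S', Match C C' ∧ SCong S S' ∧ HasType Γ C' .proc ∧ HasType Γ S' .proc := by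
  obtain ⟨P₀, Γ, h₀, ht⟩ := hP
  obtain ⟨P', C', M, hd, e, hm, hS⟩ := exists_devs_of_scong_par hC (h₀.symm.trans h)
  have hc := (ht.devs hd).comps
  rw [e] at hc
  exact ⟨Γ, C', HOmp.parMultiset M, hm, hS, hc C' (Multiset.mem_cons_self _ _),
    .parMultiset fun C hC => hc C (Multiset.mem_cons_of_mem hC)⟩

theorem IsProc.head {P A S : Term} {h : Head} (hP : IsProc P)
    (hs : SCong P (.par (h.fill A) S)) : IsProc S := by
  obtain ⟨Γ, _, S', _, hS, _, ht⟩ := hP.split (h.fill_match A) hs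
  exact ⟨S', Γ, hS, ht⟩

theorem IsProc.inp {P P₁ P₂ : Term} {m : Name} (hP : IsProc P)
    (hs : SCong P (.par (.inp m P₁) P₂)) : IsProc (.par P₁ P₂.shift) := by
  obtain ⟨Γ, C, S', hm, hS, hC, ht⟩ := hP.split (.inp m (.refl P₁)) hs
  cases hm with
  | inp _ h =>
    cases hC with
    | inp hC => exact ⟨_, _, .par h hS.shift, .par hC (ht.shift _)⟩
  | neutral hn => cases hn

/-- By Church–Rosser the typed representative would reduce to an abstraction, which cannot have the
type `.proc` that reduction preserves. -/
theorem IsProc.not_isAbstraction {P : Term} (hP : IsProc P) : ¬ IsAbstraction P := by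
  obtain ⟨P₀, Γ, h₀, ht⟩ := hP
  have pabs {A Y : Term} (h : Devs (.pabs A) Y) : ∃ B, Y = .pabs B := by
    induction h with
    | refl => exact ⟨A, rfl⟩
    | tail _ h ih =>
      obtain ⟨B, rfl⟩ := ih
      cases h
      exact ⟨_, rfl⟩
  have nabs {A Y : Term} (h : Devs (.nabs A) Y) : ∃ B, Y = .nabs B := by
    induction h with
    | refl => exact ⟨A, rfl⟩
    | tail _ h ih =>
      obtain ⟨B, rfl⟩ := ih
      cases h
      exact ⟨_, rfl⟩
  rintro (⟨A, hA⟩ | ⟨A, hA⟩)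
  · obtain ⟨X, Y, hX, hY, a⟩ := (h₀.symm.trans hA).joinable
    obtain ⟨B, rfl⟩ := pabs hY
    obtain ⟨B', rfl, _⟩ := a.symm.like
    cases ht.devs hX
  · obtain ⟨X, Y, hX, hY, a⟩ := (h₀.symm.trans hA).joinable
    obtain ⟨B, rfl⟩ := nabs hY
    obtain ⟨B', rfl, _⟩ := a.symm.like
    cases ht.devs hX

/-! ### Typed terms have finitely many observations -/

/-- Removal of one observable component; an input is replaced by its continuation. -/
inductive Step (P P' : Term) : Prop
  | head (h : Head) (A : Term) : SCong P (.par (h.fill A) P') → Step P P'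
  | inp (m : Name) (P₁ P₂ : Term) : SCong P (.par (.inp m P₁) P₂) →
      SCong P' (.par P₁ P₂.shift) → Step P P'

/-- Sequences of observations of the term have length at most `n`. -/
def Bounded : ℕ → Term → Prop
  | 0, P => ∀ P', ¬ Step P P'
  | n + 1, P => ∀ P', Step P P' → Bounded n P'

theorem Bounded.scong {n : ℕ} {P Q : Term} (hP : Bounded n P) (h : SCong Q P) : Bounded n Q := by
  have hs {P'} (s : Step Q P') : Step P P' := by
    cases s with
    | head hd A hQ => exact .head hd A (h.symm.trans hQ)
    | inp m P₁ P₂ hQ h' => exact .inp m P₁ P₂ (h.symm.trans hQ) h'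
  cases n with
  | zero => exact fun P' s => hP P' (hs s)
  | succ n => exact fun P' s => hP P' (hs s)

theorem Step.of_rename {P X : Term} {ρ : ℕ → ℕ} (s : Step (P.rename ρ) X) :
    ∃ P' ρ', Step P P' ∧ SCong X (P'.rename ρ') := by
  cases s with
  | head h A hP =>
    obtain ⟨h', A', P₂, hP', _, _, hS⟩ := hP.head_of_rename
    exact ⟨P₂, ρ, .head h' A' hP', hS⟩
  | inp m A S hP hX =>
    obtain ⟨P₁, P₂, hP', hA, hS⟩ := hP.inp_of_rename
    refine ⟨_, renUp ρ, .inp m P₁ P₂ hP' (.refl _), hX.trans (.par hA ?_)⟩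
    rw [Term.shift_rename]
    exact hS.shift

theorem Bounded.rename {n : ℕ} : ∀ {P : Term}, Bounded n P → ∀ ρ, Bounded n (P.rename ρ) := by
  induction n with
  | zero =>
    intro P h ρ X s
    obtain ⟨P', _, s', _⟩ := s.of_rename
    exact h P' s'
  | succ n ih =>
    intro P h ρ X s
    obtain ⟨P', ρ', s', e⟩ := s.of_rename
    exact (ih (h P' s') ρ').scong e

/-- The renaming is `id` for heads and `Nat.succ` for inputs, where the bystander is weakened by the
input variable. -/
theorem Step.par_split {P Q X : Term} (s : Step (.par P Q) X) :
    (∃ P' ρ, Step P P' ∧ SCong X (.par P' (Q.rename ρ))) ∨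
      ∃ Q' ρ, Step Q Q' ∧ SCong X (.par (P.rename ρ) Q') := by
  cases s with
  | head h A hP =>
    rcases hP.par_split (h.fill_match A) with ⟨P₂, hP, hX⟩ | ⟨Q₂, hQ, hX⟩
    · refine .inl ⟨P₂, id, .head h A hP, ?_⟩
      rwa [Term.rename_id]
    · refine .inr ⟨Q₂, id, .head h A hQ, ?_⟩
      rwa [Term.rename_id]
  | inp m P₁ S hP hX =>
    rcases hP.par_split (.inp m (.refl P₁)) with ⟨P₂, hP, hS⟩ | ⟨Q₂, hQ, hS⟩
    · exact .inl ⟨_, Nat.succ, .inp m P₁ P₂ hP (.refl _),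
        (hX.trans (.par (.refl _) hS.shift)).trans (SCong.par_assoc _ _ _).symm⟩
    · exact .inr ⟨_, Nat.succ, .inp m P₁ Q₂ hQ (.refl _),
        (hX.trans (.par (.refl _) hS.shift)).trans (.par_left_comm _ _ _)⟩

/-- Observations of a composition interleave those of its sides, since interactions are not
observed; hence the bounds add up. -/
theorem Bounded.par {n k : ℕ} {P Q : Term} (hP : Bounded n P) (hQ : Bounded k Q) :
    Bounded (n + k) (.par P Q) := by
  induction hs : n + k generalizing n k P Q with
  | zero =>
    obtain ⟨rfl, rfl⟩ : n = 0 ∧ k = 0 := by omega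
    intro X s
    rcases s.par_split with ⟨P', _, s, _⟩ | ⟨Q', _, s, _⟩
    · exact hP P' s
    · exact hQ Q' s
  | succ s ih =>
    intro X st
    rcases st.par_split with ⟨P', ρ, s', e⟩ | ⟨Q', ρ, s', e⟩
    · cases n with
      | zero => exact absurd s' (hP P')
      | succ n => exact (ih (hP P' s') (hQ.rename ρ) (by omega)).scong e
    · cases k with
      | zero => exact absurd s' (hQ Q')
      | succ k => exact (ih (hP.rename ρ) (hQ Q' s') (by omega)).scong e

theorem not_scong_nil_par {C S : Term} (hC : Match C C) : ¬ SCong .nil (.par C S) := by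
  intro h
  obtain ⟨P', C', M, hd, e, _⟩ := exists_devs_of_scong_par hC h
  have : P' = .nil := by
    clear e
    induction hd with
    | refl => rfl
    | tail _ h ih =>
      subst ih
      cases h
      rfl
  subst this
  exact Multiset.zero_ne_cons e

theorem Bounded.nil (n : ℕ) : Bounded n .nil := by
  have hs (X : Term) : ¬ Step .nil X := by
    rintro (⟨h, A, hP⟩ | ⟨m, P₁, P₂, hP, _⟩)
    · exact not_scong_nil_par (h.fill_match A) hP
    · exact not_scong_nil_par (.inp m (.refl P₁)) hP
  cases n with
  | zero => exact hs
  | succ n => exact fun X s => absurd s (hs X)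

/-- A rigid term is its own only component, so nothing is left beside `C`, and both match a common
reduct `N'`. -/
theorem Match.split {N C S : Term} (hN : Match N N) (hC : Match C C)
    (h : SCong N (.par C S)) : ∃ N', Match N N' ∧ Match C N' ∧ SCong S .nil := by
  obtain ⟨N', C', M, hd, e, hm, hS⟩ := exists_devs_of_scong_par hC h
  have hN' := hN.devs hd
  rw [hN'.comps, Multiset.singleton_eq_cons_iff] at e
  obtain ⟨rfl, rfl⟩ := e
  exact ⟨N', hN', hm, hS.trans parMultiset_zero⟩

theorem NeutralMatch.not_match_inp {N P N' : Term} {m : Name} (hN : NeutralMatch N N')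
    (h : Match (.inp m P) N') : False := by
  cases h with
  | inp _ _ => cases hN
  | neutral h => cases h

theorem Bounded.neutral {N : Term} (hN : NeutralMatch N N) : Bounded 1 N := by
  rintro X (⟨h, A, hP⟩ | ⟨m, P₁, P₂, hP, hX⟩)
  · obtain ⟨_, _, _, hX⟩ := (Match.neutral hN).split (h.fill_match A) hP
    exact (Bounded.nil 0).scong hX
  · obtain ⟨N', C', M, hd, e, hm, _⟩ := exists_devs_of_scong_par (.inp m (.refl P₁)) hP
    have hN' := hN.devs hd
    rw [hN'.comps, Multiset.singleton_eq_cons_iff] at e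
    obtain ⟨rfl, rfl⟩ := e
    exact (hN'.not_match_inp hm).elim

/-- Only residuals are followed by `Step`, so the bound does not depend on the payload. -/
theorem Bounded.out (m : Name) (A : Term) : Bounded 1 (.out m A) := by
  rintro X (⟨h, B, hP⟩ | ⟨m', P₁, P₂, hP, hX⟩)
  · obtain ⟨_, _, _, hX⟩ := (Match.out m (.refl A)).split (h.fill_match B) hP
    exact (Bounded.nil 0).scong hX
  · obtain ⟨N', h₁, h₂, _⟩ := (Match.out m (.refl A)).split (.inp m' (.refl P₁)) hP
    cases h₂ with
    | inp _ _ =>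
      cases h₁ with
      | neutral h => cases h
    | neutral h => cases h

theorem Bounded.inp {n : ℕ} {P : Term} (h : Bounded n P) (m : Name) :
    Bounded (n + 1) (.inp m P) := by
  rintro X (⟨h, B, hP⟩ | ⟨m', P₁, P₂, hP, hX⟩)
  · obtain ⟨_, _, _, hX⟩ := (Match.inp m (.refl P)).split (h.fill_match B) hP
    exact (Bounded.nil n).scong hX
  · obtain ⟨N', h₁, h₂, h₃⟩ := (Match.inp m (.refl P)).split (.inp m' (.refl P₁)) hP
    cases h₂ with
    | inp _ e₂ =>
      cases h₁ with
      | inp _ e₁ =>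
        exact h.scong ((hX.trans (.par (e₂.trans e₁.symm) h₃.shift)).trans (.par_nil _))
      | neutral h => cases h
    | neutral h => cases h

/-- Reducibility: hereditarily over the type, applications yield bounded terms, in every
renaming of the term. -/
def Reducible : Ty → Term → Prop
  | .proc, P => ∃ n, Bounded n P
  | .pabs S T, P => ∀ ρ Q, Reducible S Q → Reducible T (.papp (P.rename ρ) Q)
  | .nabs T, P => ∀ n, Reducible T (.napp P n)

theorem Reducible.scong {T : Ty} : ∀ {P Q : Term}, Reducible T P → SCong Q P → Reducible T Q := by
  induction T with
  | proc =>
    rintro P Q ⟨n, h⟩ e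
    exact ⟨n, h.scong e⟩
  | pabs S T _ ih => exact fun h e ρ A hA => ih (h ρ A hA) (.papp (e.rename ρ) (.refl A))
  | nabs T ih => exact fun h e n => ih (h n) (.napp n e)

theorem Reducible.rename {T : Ty} : ∀ {P : Term}, Reducible T P → ∀ ρ,
    Reducible T (P.rename ρ) := by
  induction T with
  | proc =>
    rintro P ⟨n, h⟩ ρ
    exact ⟨n, h.rename ρ⟩
  | pabs S T _ _ =>
    intro P h ρ ρ' A hA
    rw [Term.rename_rename]
    exact h _ A hA
  | nabs T ih => exact fun h ρ n => ih (h n) ρ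

theorem NeutralMatch.rename {N : Term} (hN : NeutralMatch N N) (ρ : ℕ → ℕ) :
    NeutralMatch (N.rename ρ) (N.rename ρ) := by
  induction N with
  | var i => exact .var _
  | papp P Q ih _ =>
    cases hN with
    | papp h _ => exact .papp (ih h) (.refl _)
  | napp P n ih =>
    cases hN with
    | napp _ h => exact .napp n (ih h)
  | _ => cases hN

/-- Makes variables reducible at every type. The arguments need no property of their own, since they
are not observed further by `Step`. -/
theorem Reducible.neutral {T : Ty} : ∀ {N : Term}, NeutralMatch N N → Reducible T N := by
  induction T with
  | proc => exact fun hN => ⟨1, .neutral hN⟩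
  | pabs S T _ ih => exact fun hN ρ A _ => ih (.papp (hN.rename ρ) (.refl A))
  | nabs T ih => exact fun hN n => ih (.napp n hN)

/-- The fundamental lemma of the reducibility method. Substituting for both kinds of variables at
once lets the induction pass under name and process abstractions. -/
theorem HasType.reducible {Γ : ℕ → Ty} {P : Term} {T : Ty} (h : HasType Γ P T) :
    ∀ (σ : ℕ → Term) (ν : ℕ → Name), (∀ i, Reducible (Γ i) (σ i)) →
      Reducible T ((P.nsubst ν).subst σ) := by
  induction h with
  | nil Γ => exact fun _ _ _ => ⟨0, .nil 0⟩
  | var Γ i => exact fun _ _ h => h i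
  | inp _ ih =>
    intro σ ν hσ
    obtain ⟨n, h⟩ := ih (termUp σ) ν fun i => by
      cases i with
      | zero => exact .neutral (.var 0)
      | succ i => exact (hσ i).rename _
    exact ⟨n + 1, h.inp _⟩
  | out _ _ => exact fun _ _ _ => ⟨1, .out _ _⟩
  | par _ _ ih₁ ih₂ =>
    intro σ ν hσ
    obtain ⟨n, h₁⟩ := ih₁ σ ν hσ
    obtain ⟨k, h₂⟩ := ih₂ σ ν hσ
    exact ⟨n + k, h₁.par h₂⟩
  | pabs _ ih =>
    intro σ ν hσ ρ Q hQ
    refine (ih (scons Q fun i => (σ i).rename ρ) ν fun i => ?_).scong ?_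
    · cases i with
      | zero => exact hQ
      | succ i => exact (hσ i).rename ρ
    -- Instantiating the renamed body by `Q` is the same as substituting `Q` for variable `0` from
    -- the start, so one application law remains.
    · rw [← Term.subst_inst, ← rename_termUp, ← Term.rename_subst]
      exact .papp_pabs _ _
  | papp _ _ ih₁ ih₂ =>
    intro σ ν hσ
    have := ih₁ σ ν hσ id _ (ih₂ σ ν hσ)
    rwa [Term.rename_id] at this
  | nabs _ ih =>
    intro σ ν hσ n
    refine (ih σ (scons n ν) hσ).scong ?_
    rw [← Term.nsubst_ninst, Term.ninst_subst]
    exact .napp_nabs _ _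
  | napp _ ih => exact fun σ ν hσ => ih σ ν hσ _

theorem HasType.bounded {Γ : ℕ → Ty} {P : Term} (h : HasType Γ P .proc) : ∃ n, Bounded n P := by
  have := h.reducible .var .var fun i => .neutral (.var i)
  rwa [Term.nsubst_var, Term.subst_var] at this

/-! ### Cancellation -/

theorem Term.shift_rename_pred (P : Term) : P.shift.rename Nat.pred = P := by
  rw [Term.shift, Term.rename_rename]
  exact P.rename_id

/-- If `U | R` and `V | R'` are bisimilar, where `R'` is `R` without a component, then `V` has such
a component as well. -/
theorem Bisim.exchange_head {n : ℕ} {U V R R' A : Term} {h : Head} (hR : Bounded n R)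
    (hs : SCong R (.par (h.fill A) R')) (hb : Bisim (.par U R) (.par V R')) :
    ∃ B V' S k, SCong V (.par (h.fill B) V') ∧ h.Payload Bisim A B ∧ Bounded k S ∧
      Bisim (.par U S) (.par V' S) := by
  induction n generalizing R R' A with
  | zero => exact absurd (.head h A hs) (hR R')
  | succ n ih =>
    have hR' : Bounded n R' := hR R' (.head h A hs)
    obtain ⟨B, Y, hY, hp, r⟩ := hb.simulates.head h A (.par U R')
      ((SCong.par (.refl U) hs).trans (.par_left_comm _ _ _))
    -- If `V` answers, `R'` is the common component. Otherwise `R'` and its residual `R''` are in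
    -- the position of `R` and `R'`, with a smaller bound.
    rcases hY.par_split (h.fill_match B) with ⟨V', hV, e⟩ | ⟨R'', hR'', e⟩
    · exact ⟨B, V', R', n, hV, hp, hR', r.scong (.refl _) e⟩
    · obtain ⟨B', V', S, k, hV, hp', hS, r'⟩ := ih hR' hR'' (r.scong (.refl _) e)
      exact ⟨B', V', S, k, hV, hp.comp hp' Bisim.trans, hS, r'⟩

/-- If `U | R` and `V | R'` are bisimilar, where `R'` is obtained from `R` by an input of
variable `0`, then `V` has such an input as well. -/
theorem Bisim.exchange_inp {n : ℕ} {U V R R₁ R₂ : Term} {m : Name} (hR : Bounded n R)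
    (hs : SCong R (.par (.inp m R₁) R₂))
    (hb : Bisim (.par U R) (.par V ((Term.par R₁ R₂.shift).rename Nat.pred))) :
    ∃ V₁ V₂ S k, SCong V (.par (.inp m V₁) V₂) ∧ Bounded k S ∧
      Bisim (.par U S) (.par ((Term.par V₁ V₂.shift).rename Nat.pred) S) := by
  induction n generalizing R R₁ R₂ with
  | zero => exact absurd (.inp m R₁ R₂ hs (.refl _)) (hR _)
  | succ n ih =>
    have hR' := (hR _ (.inp m R₁ R₂ hs (.refl _))).rename Nat.pred
    set R' := (Term.par R₁ R₂.shift).rename Nat.pred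
    obtain ⟨Y₁, Y₂, hY, r⟩ := hb.simulates.inp m R₁ (.par U R₂)
      ((SCong.par (.refl U) hs).trans (.par_left_comm _ _ _))
    -- `Nat.pred` sends both `0` and `1` to `0`: it identifies the new input variable with the
    -- existing variable `0` and undoes the weakening of bystanders.
    have r₁ : Bisim (.par U R') ((Term.par Y₁ Y₂.shift).rename Nat.pred) := by
      refine Bisim.scong ?_ (r.rename Nat.pred) (.refl _)
      change SCong (.par U (.par (R₁.rename Nat.pred) (R₂.shift.rename Nat.pred)))
        (.par (R₁.rename Nat.pred) (.par (U.shift.rename Nat.pred) (R₂.shift.rename Nat.pred)))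
      rw [Term.shift_rename_pred, Term.shift_rename_pred]
      exact .par_left_comm _ _ _
    rcases hY.par_split (.inp m (.refl Y₁)) with ⟨V₂, hV, e⟩ | ⟨R₃, hR₃, e⟩
    · refine ⟨Y₁, V₂, R', n, hV, hR', r₁.scong (.refl _) ?_⟩
      have := ((SCong.par (.refl Y₁) e.shift).trans (SCong.par_assoc _ _ _).symm).rename Nat.pred
      refine this.trans ?_
      change SCong (.par _ (R'.shift.rename Nat.pred)) _
      rw [Term.shift_rename_pred]
      exact .refl _
    · refine ih hR' hR₃ (r₁.scong (.refl _) ?_)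
      have := ((SCong.par (.refl Y₁) e.shift).trans (.par_left_comm _ _ _)).rename Nat.pred
      refine this.trans ?_
      change SCong (.par (V.shift.rename Nat.pred) _) _
      rw [Term.shift_rename_pred]
      exact .refl _

/-- Pairs of processes that are bisimilar next to a common bounded component. -/
def CancelRel (P Q : Term) : Prop :=
  IsProc P ∧ IsProc Q ∧ ∃ R n, Bounded n R ∧ Bisim (.par P R) (.par Q R)

theorem CancelRel.head {P Q A P' : Term} {h : Head} (hr : CancelRel P Q)
    (hP' : SCong P (.par (h.fill A) P')) :
    ∃ B Q', SCong Q (.par (h.fill B) Q') ∧ h.Payload Bisim A B ∧ CancelRel P' Q' := by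
  obtain ⟨hP, hQ, R, n, hR, hb⟩ := hr
  obtain ⟨B, Y, hY, hp, r⟩ := hb.simulates.head h A (.par P' R)
    ((SCong.par hP' (.refl R)).trans (.par_assoc _ _ _))
  rcases hY.par_split (h.fill_match B) with ⟨Q', hQ', e⟩ | ⟨R', hR', e⟩
  · exact ⟨B, Q', hQ', hp, hP.head hP', hQ.head hQ', R, n, hR, r.scong (.refl _) e⟩
  · obtain ⟨B', Q', S, k, hQ', hp', hS, r'⟩ :=
      Bisim.exchange_head hR hR' (r.scong (.refl _) e)
    exact ⟨B', Q', hQ', hp.comp hp' Bisim.trans, hP.head hP', hQ.head hQ', S, k, hS, r'⟩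

theorem CancelRel.inp {P Q P₁ P₂ : Term} {m : Name} (hr : CancelRel P Q)
    (hP' : SCong P (.par (.inp m P₁) P₂)) :
    ∃ Q₁ Q₂, SCong Q (.par (.inp m Q₁) Q₂) ∧
      CancelRel (.par P₁ P₂.shift) (.par Q₁ Q₂.shift) := by
  obtain ⟨hP, hQ, R, n, hR, hb⟩ := hr
  obtain ⟨Y₁, Y₂, hY, r⟩ := hb.simulates.inp m P₁ (.par P₂ R)
    ((SCong.par hP' (.refl R)).trans (.par_assoc _ _ _))
  have r₁ : Bisim (.par (.par P₁ P₂.shift) R.shift) (.par Y₁ Y₂.shift) :=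
    r.scong (.par_assoc _ _ _) (.refl _)
  rcases hY.par_split (.inp m (.refl Y₁)) with ⟨Q₂, hQ', e⟩ | ⟨R₂, hR', e⟩
  · refine ⟨Y₁, Q₂, hQ', hP.inp hP', hQ.inp hQ', R.shift, n, hR.rename _, r₁.scong (.refl _) ?_⟩
    exact (SCong.par (.refl _) e.shift).trans (SCong.par_assoc _ _ _).symm
  -- The residual of `R` is presented as an input of the weakened `R` whose variable has been merged
  -- with variable `0`, as `Bisim.exchange_inp` requires: `renUp Nat.succ` leaves a gap at index
  -- `1`, and `Nat.pred` closes it.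
  · have pred_up (T : Term) : (T.rename (renUp Nat.succ)).rename Nat.pred = T := by
      rw [Term.rename_rename]
      convert T.rename_id using 2
      exact scons_ext rfl fun _ => rfl
    obtain ⟨V₁, V₂, S, k, hV, hS, r'⟩ :=
      Bisim.exchange_inp (U := .par P₁ P₂.shift) (V := Q.shift) (hR.rename Nat.succ)
        (hR'.rename Nat.succ) <| r₁.scong (.refl _) <| by
          refine ((SCong.par (.refl _) e.shift).trans (.par_left_comm _ _ _)).trans ?_
          change SCong (.par Q.shift (.par Y₁ R₂.shift)) (.par Q.shift
            (.par ((Y₁.rename (renUp Nat.succ)).rename Nat.pred)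
              (R₂.shift.shift.rename Nat.pred)))
          rw [pred_up, Term.shift_rename_pred]
          exact .refl _
    -- The input was found in the weakening of `Q`; reflecting it along `Nat.succ` gives an input of
    -- `Q` itself.
    obtain ⟨Q₁, Q₂, hQ', e₁, e₂⟩ := hV.inp_of_rename
    refine ⟨Q₁, Q₂, hQ', hP.inp hP', hQ.inp hQ', S, k, hS, r'.scong (.refl _) ?_⟩
    refine .par ?_ (.refl S)
    change SCong (.par (V₁.rename Nat.pred) (V₂.shift.rename Nat.pred)) _
    rw [Term.shift_rename_pred]
    refine .par ?_ e₂
    have := e₁.rename Nat.pred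
    rwa [pred_up] at this

theorem CancelRel.bisim {P Q : Term} (h : CancelRel P Q) : Bisim P Q := by
  -- Bisimilarity is added because payloads are compared by `Bisim`, while residuals stay in
  -- `CancelRel`.
  refine Bisim.coinduct (R := fun P Q => CancelRel P Q ∨ Bisim P Q) ?_ ?_ (.of (.inl h))
  · rintro P Q (⟨hP, hQ, R, n, hR, hb⟩ | h)
    · exact .inl ⟨hQ, hP, R, n, hR, hb.symm⟩
    · exact .inr h.symm
  · rintro P Q (h | h)
    · refine ⟨fun _ => h.2.1.not_isAbstraction, ?_, ?_, ?_, ?_⟩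
      · exact fun A hA => absurd (.inl ⟨A, hA⟩) h.1.not_isAbstraction
      · exact fun A hA => absurd (.inr ⟨A, hA⟩) h.1.not_isAbstraction
      · intro hd A P' hP
        obtain ⟨B, Q', hQ, hp, r⟩ := h.head hP
        exact ⟨B, Q', hQ, hp.mono fun h => .of (.inr h), .of (.inl r)⟩
      · intro m P₁ P₂ hP
        obtain ⟨Q₁, Q₂, hQ, r⟩ := h.inp hP
        exact ⟨Q₁, Q₂, hQ, .of (.inl r)⟩
    · exact h.simulates.mono fun h => .of (.inr h)

theorem WellFormed.par_inv {P Q : Term} (h : WellFormed (.par P Q)) :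
    ∃ Γ, HasType Γ P .proc ∧ HasType Γ Q .proc := by
  obtain ⟨Γ, T, h⟩ := h
  cases h with
  | par h₁ h₂ => exact ⟨Γ, h₁, h₂⟩

end HOmp

theorem mainTheorem7 (P Q R : HOmp.Term)
    (hPR : HOmp.WellFormed (HOmp.Term.par P R)) (hQR : HOmp.WellFormed (HOmp.Term.par Q R))
    (h : HOmp.Bisim (HOmp.Term.par P R) (HOmp.Term.par Q R)) :
    HOmp.Bisim P Q := by
  obtain ⟨Γ, hP, hR⟩ := hPR.par_inv
  obtain ⟨Δ, hQ, _⟩ := hQR.par_inv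
  obtain ⟨n, hn⟩ := hR.bounded
  exact HOmp.CancelRel.bisim ⟨⟨P, Γ, .refl P, hP⟩, ⟨Q, Δ, .refl Q, hQ⟩, R, n, hn, h⟩
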